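/- **Theorem 1.3 (Generalized Koshliakov transform).** Notation. For complex lists $a_1,\dots,a_p$ and $b_1,\dots,b_q$ with $0\le m\le q$, $0\le n\le p$ and $z\in\mathbb C\setminus\{0\}$, the Meijer $G$-function is $$G^{m,n}_{p,q}\Big(\begin{matrix}a_1,\dots,a_p\\ b_1,\dots,b_q\end{matrix}\Big|\,z\Big)=\frac1{2\pi i}\int_{L}\frac{\prod_{j=1}^m\Gamma(b_j-s)\prod_{j=1}^n\Gamma(1-a_j+s)}{\prod_{j=m+1}^q\Gamma(1-b_j+s)\prod_{j=n+1}^p\Gamma(a_j-s)}\,z^s\,ds ,\qquad z^s=e^{s\log z}\text{ (principal branch)}.$$ Put $\delta=m+n-\frac12(p+q)$. If $|\arg z|<\delta\pi$, then $L$ is a vertical line from $C-i\infty$ to $C+i\infty$ that has the poles of $\Gamma(b_j-s)$, $1\le j\le m$, on its right and the poles of $\Gamma(1-a_j+s)$, $1\le j\le n$, on its left. Otherwise (for $p<q$) $L$ is a loop that begins and ends at $+\infty$ and encircles the poles of $\Gamma(b_j-s)$, $1\le j\le m$, once in the negative direction, but no pole of $\Gamma(1-a_j+s)$, $1\le j\le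 n$. (In every instance below $p<q$, and some vertical line separates the two sets of poles.) $K_\mu$ is the modified Bessel function of the second kind, and $(v)_\ell$ denotes $v$ repeated $\ell$ times. Let $\mathbb K$ be a number field of degree $d$ and signature $(r_1,r_2)$, so $d=r_1+2r_2$. For $\nu\in\mathbb C$ and $x\in\mathbb C\setminus\{0\}$ put $$G_{\mathbb K,\nu}(x)=G^{d+1,0}_{0,2(d+1)}\Big(\begin{matrix}-\\ -\frac\nu2,(\frac\nu2)_{r_1+r_2},(\frac{1+\nu}2)_{r_2};\ \frac{1-\nu}2,(\frac\nu2)_{r_2},(\frac{1+\nu}2)_{r_1+r_2}\end{matrix}\Big|\,\frac{x^2}{16}\Big).$$ (i) Let $\mu,\nu\in\mathbb C$ with $\mathrm{Re}(\mu),\ \mathrm{Re}(\nu),\ \mathrm{Re}(\mu+\nu)>-\frac12$, and let $x\in\mathbb C\setminus\{0\}$. Then the following integral converges absolutely, and $$\int_0^\infty K_\mu(t)\,t^{\mu+\nu}\,G_{\mathbb K,\nu}(xt)\,dt=2^{\mu+\nu-1}\,G^{d+1,1}_{1,2d+1}\Big(\begin{matrix}\frac{1-2\mu-\nu}2\\ -\frac\nu2,(\frac\nu2)_{r_1+r_2},(\frac{1+\nu}2)_{r_2},(\frac\nu2)_{r_2},(\frac{1+\nu}2)_{r_1+r_2}\end{matrix}\Big|\,\frac{x^2}4\Big).$$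 (ii) In particular (the case $\mu=-\nu$), let $-\frac12<\mathrm{Re}(\nu)<\frac12$ and $x\in\mathbb C\setminus\{0\}$. Then the following integral converges absolutely, and $$\int_0^\infty K_\nu(t)\,G_{\mathbb K,\nu}(xt)\,dt=\frac12\,G^{d+1,0}_{0,2d}\Big(\begin{matrix}-\\ -\frac\nu2,(\frac\nu2)_{r_1+r_2},(\frac{1+\nu}2)_{r_2},(\frac\nu2)_{r_2},(\frac{1+\nu}2)_{r_1+r_2-1}\end{matrix}\Big|\,\frac{x^2}4\Big).$$ -/

import Mathlib

open Complex MeasureTheory Set Filter Topology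

noncomputable section

/-! ### Bessel functions -/

/-- The modified Bessel function of the first kind `I_ν(z)`, with the principal branch of
`(z / 2) ^ (ν + 2 k)`. A term with `Γ(ν + k + 1) = ∞` is `0`, as it should be: `Complex.Gamma`
takes the value `0` at its poles, and `a / 0 = 0`. -/
def besselI (ν z : ℂ) : ℂ :=
  ∑' k : ℕ, (z / 2) ^ (ν + 2 * (k : ℂ)) / ((k.factorial : ℂ) * Gamma (ν + (k : ℂ) + 1))

/-- The quotient `(π / 2) (I_{-ν}(z) - I_ν(z)) / sin(π ν)` for non-integral `ν`. -/
def besselKQuot (ν z : ℂ) : ℂ :=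
  (Real.pi : ℂ) / 2 * ((besselI (-ν) z - besselI ν z) / sin ((Real.pi : ℂ) * ν))

open Classical in
/-- The modified Bessel function of the second kind `K_ν(z)`; for integral `ν` it is the limit of
the quotient as the order tends to `ν`. -/
def besselK (ν z : ℂ) : ℂ :=
  if ∃ k : ℤ, ν = (k : ℂ) then limUnder (𝓝[≠] ν) (fun α : ℂ => besselKQuot α z)
  else besselKQuot ν z

/-! ### The Meijer G-function

The parameters of `G^{m,n}_{p,q}` are given as lists `a = [a_1, …, a_p]` and `b = [b_1, …, b_q]`,
so that `p` and `q` are the lengths of `a` and `b`. -/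

/-- The integrand
`∏_{j ≤ m} Γ(b_j - s) ∏_{j ≤ n} Γ(1 - a_j + s) / (∏_{j > m} Γ(1 - b_j + s) ∏_{j > n} Γ(a_j - s)) z^s`.
Where a Gamma function in the denominator has a pole, the quotient is `0`, which is the correct
value. -/
def meijerIntegrand (m n : ℕ) (a b : List ℂ) (z s : ℂ) : ℂ :=
  (((b.take m).map fun β => Gamma (β - s)).prod * ((a.take n).map fun α => Gamma (1 - α + s)).prod)
    / (((b.drop m).map fun β => Gamma (1 - β + s)).prod * ((a.drop n).map fun α => Gamma (α - s)).prod)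
    * z ^ s

/-- The vertical line `Re s = C` separates the poles: the poles `b_j + k` of `Γ(b_j - s)`, `j ≤ m`,
lie to the right of it and the poles `a_j - 1 - k` of `Γ(1 - a_j + s)`, `j ≤ n`, to the left. -/
def MeijerSeparates (m n : ℕ) (a b : List ℂ) (C : ℝ) : Prop :=
  (∀ β ∈ b.take m, C < β.re) ∧ (∀ α ∈ a.take n, α.re - 1 < C)

/-- An abscissa `C` of a separating vertical line (any such line, if there is one; the integrals
below do not depend on which one is taken). -/
def meijerAbscissa (m n : ℕ) (a b : List ℂ) : ℝ :=
  Classical.epsilon fun C : ℝ => MeijerSeparates m n a b C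

/-- A height that exceeds the absolute values of the imaginary parts of all poles of
`Γ(b_j - s)`, `j ≤ m`. -/
def meijerHeight (m : ℕ) (b : List ℂ) : ℝ :=
  1 + ((b.take m).map fun β => |β.im|).sum

/-- `(2 π i)⁻¹ ∫ F(s) ds` along the vertical line from `C - i ∞` to `C + i ∞`. -/
def lineIntegral (F : ℂ → ℂ) (C : ℝ) : ℂ :=
  (2 * (Real.pi : ℂ) * I)⁻¹ * (I * ∫ y : ℝ, F ((C : ℂ) + (y : ℂ) * I))

/-- `(2 π i)⁻¹ ∫ F(s) ds` along the loop which comes from `+∞ - i R`, runs to `C - i R`, then to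
`C + i R`, and back to `+∞ + i R`. It encircles its interior in the negative direction. -/
def loopIntegral (F : ℂ → ℂ) (C R : ℝ) : ℂ :=
  (2 * (Real.pi : ℂ) * I)⁻¹ *
    (-(∫ x in Ioi C, F ((x : ℂ) - (R : ℂ) * I))
      + I * (∫ y in (-R)..R, F ((C : ℂ) + (y : ℂ) * I))
      + ∫ x in Ioi C, F ((x : ℂ) + (R : ℂ) * I))

open Classical in
/-- The Meijer G-function `G^{m,n}_{p,q}(a; b | z)`, `z ≠ 0`, as a Mellin-Barnes integral.
With `δ = m + n - (p + q) / 2`, the path is a separating vertical line if `|arg z| < δ π`, which is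
where the integral along that line converges absolutely at an exponential rate. Otherwise the path
is a loop that begins and ends at `+∞` and encircles the poles of `Γ(b_j - s)`, `j ≤ m`, once in the
negative direction, but no pole of `Γ(1 - a_j + s)`, `j ≤ n`; the integral along it converges
absolutely for all `z ≠ 0` if `p < q`. This is the classical definition for `p < q` (provided that
some vertical line separates the poles); the two integrals agree where both converge. -/
def meijerG (m n : ℕ) (a b : List ℂ) (z : ℂ) : ℂ :=
  if |arg z| < ((m : ℝ) + (n : ℝ) - ((a.length : ℝ) + (b.length : ℝ)) / 2) * Real.pi then
    lineIntegral (meijerIntegrand m n a b z) (meijerAbscissa m n a b)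
  else
    loopIntegral (meijerIntegrand m n a b z) (meijerAbscissa m n a b) (meijerHeight m b)

/-! ### The generalized Koshliakov kernel -/

/-- The kernel `G_{K,ν}(x)` of a number field `K` of degree `d` and signature `(r₁, r₂)`, that is
`G^{d+1,0}_{0,2(d+1)}(-; b | x² / 16)` where `b` consists of
`-ν/2, (ν/2)_{r₁+r₂}, ((1+ν)/2)_{r₂}; (1-ν)/2, (ν/2)_{r₂}, ((1+ν)/2)_{r₁+r₂}`
and `(v)_l` stands for `v` repeated `l` times. -/
def koshliakovKernel (K : Type*) [Field K] [NumberField K] (ν x : ℂ) : ℂ :=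
  meijerG (Module.finrank ℚ K + 1) 0 []
    ([-ν / 2]
      ++ List.replicate
          (NumberField.InfinitePlace.nrRealPlaces K + NumberField.InfinitePlace.nrComplexPlaces K)
          (ν / 2)
      ++ List.replicate (NumberField.InfinitePlace.nrComplexPlaces K) ((1 + ν) / 2)
      ++ [(1 - ν) / 2]
      ++ List.replicate (NumberField.InfinitePlace.nrComplexPlaces K) (ν / 2)
      ++ List.replicate
          (NumberField.InfinitePlace.nrRealPlaces K + NumberField.InfinitePlace.nrComplexPlaces K)
          ((1 + ν) / 2))
    (x ^ 2 / 16)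

end

/-! ### Contour integrals over loops and lines -/

/-! The variable t enters the kernel only through powers: if F(s) is its Gamma quotient times
(x²/16)^s, the kernel at xt is the loop integral of F(s) t^(2s). After interchanging integrals, the
t-integral is the Mellin transform of K_μ (`besselK_mellin`) at w = μ + ν + 2s + 1, which equals
2^(μ+ν-1) 4^s Γ((1+ν)/2 + s) Γ((1+2μ+ν)/2 + s). The first Gamma cancels the denominator factor of
the parameter (1-ν)/2, the second is the numerator factor of the parameter (1-2μ-ν)/2, and 4^s turns
x²/16 into x²/4. This is `besselK_meijerG_integral`. For μ = -ν the upper parameter equals the lower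
parameter (1+ν)/2, and one pair cancels (`meijerG_one_concat`).

Contours: the kernel has δ = 0 and is always a loop integral, while the right-hand sides have δ = 1
and are line or loop integrals according to arg x². `meijerG_eq_loopIntegral` makes all of them
loops with any separating abscissa. It rests on `exists_norm_meijerIntegrand_le`: reflection trades
Γ(β - s) for 1/Γ(1 - β + s) and a factor of order exp(-π |Im s|), the other numerator Gammas are
paired with denominator Gammas at polynomial cost, and the q - p reciprocal Gammas left over beat
every exponential in Re s. The same bound with two extra upper parameters justifies the interchange.

Bessel function: K is defined through the power series of I. Hankel's loop integral for 1/Γ, summed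
termwise, gives Schläfli's integral for I; the difference of the orders -ν and ν then gives K_ν(t) =
½ ∫ exp(-t cosh u - νu) du (`besselK_eq_integral`), with integral orders reached by continuity. The
Mellin transform follows by Fubini. -/

theorem loopIntegral_shift {F : ℂ → ℂ} {C C' R : ℝ} (hC : C ≤ C') (hR : 0 ≤ R)
    (hF : DifferentiableOn ℂ F {s | s.re ∈ Icc C C' ∧ |s.im| ≤ R})
    (hu : IntegrableOn (fun x : ℝ => F ((x : ℂ) + (R : ℂ) * I)) (Ioi C))
    (hl : IntegrableOn (fun x : ℝ => F ((x : ℂ) - (R : ℂ) * I)) (Ioi C)) :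
    loopIntegral F C R = loopIntegral F C' R := by
  have key := Complex.integral_boundary_rect_eq_zero_of_differentiableOn F
    (⟨C, -R⟩ : ℂ) (⟨C', R⟩ : ℂ) (hF.mono (by
      rintro s ⟨h1, h2⟩
      simp only [mem_preimage] at h1 h2
      rw [uIcc_of_le hC] at h1
      rw [uIcc_of_le (by linarith)] at h2
      exact ⟨h1, abs_le.2 h2⟩))
  have e1 := intervalIntegral.integral_interval_add_Ioi hu (hu.mono_set (Ioi_subset_Ioi hC))
  have e2 := intervalIntegral.integral_interval_add_Ioi hl (hl.mono_set (Ioi_subset_Ioi hC))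
  simp only [smul_eq_mul, ofReal_neg, neg_mul, ← sub_eq_add_neg] at key
  unfold loopIntegral
  rw [← e1, ← e2]
  congr 1
  linear_combination -key

theorem integrableOn_of_norm_le_exp {f : ℝ → ℂ} {a M ε : ℝ} (hε : 0 < ε)
    (hf : ContinuousOn f (Ici a)) (hb : ∀ x, a ≤ x → ‖f x‖ ≤ M * Real.exp (-ε * x)) :
    IntegrableOn f (Ioi a) := by
  refine Integrable.mono' ((integrableOn_exp_mul_Ioi (a := -ε) (by linarith) a).const_mul M)
    ((hf.mono Ioi_subset_Ici_self).aestronglyMeasurable measurableSet_Ioi) ?_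
  exact (ae_restrict_iff' measurableSet_Ioi).2 (.of_forall fun x hx => hb x (le_of_lt hx))

/-- The integral over a vertical ray equals the one over the horizontal ray with the same origin,
for functions that decay exponentially in the quadrant between them. -/
theorem integral_vertical_ray_eq_horizontal {F : ℂ → ℂ} {C R ε M σ : ℝ} (hσ : σ = 1 ∨ σ = -1)
    (hε : 0 < ε)
    (hF : DifferentiableOn ℂ F {s | C ≤ s.re ∧ R ≤ σ * s.im})
    (hb : ∀ s : ℂ, C ≤ s.re → R ≤ σ * s.im →
      ‖F s‖ ≤ M * Real.exp (-ε * (σ * s.im)) * Real.exp (-ε * s.re)) :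
    IntegrableOn (fun y : ℝ => F ((C : ℂ) + (σ * y : ℝ) * I)) (Ioi R) ∧
    IntegrableOn (fun x : ℝ => F ((x : ℂ) + (σ * R : ℝ) * I)) (Ioi C) ∧
    (σ : ℂ) * I * ∫ y in Ioi R, F ((C : ℂ) + (σ * y : ℝ) * I)
      = ∫ x in Ioi C, F ((x : ℂ) + (σ * R : ℝ) * I) := by
  have hσσ : σ * σ = 1 := by rcases hσ with rfl | rfl <;> norm_num
  have hσm : ∀ y : ℝ, σ * (σ * y) = y := fun y => by rw [← mul_assoc, hσσ, one_mul]
  have hv : IntegrableOn (fun y : ℝ => F ((C : ℂ) + (σ * y : ℝ) * I)) (Ioi R) := by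
    refine integrableOn_of_norm_le_exp (M := M * Real.exp (-ε * C)) hε ?_ ?_
    · refine hF.continuousOn.comp (by fun_prop) fun y hy => ?_
      simpa [hσm] using hy
    · intro y hy
      refine (hb _ (by simp) (by simpa [hσm] using hy)).trans (le_of_eq ?_)
      simp [hσm]; ring
  have hh : IntegrableOn (fun x : ℝ => F ((x : ℂ) + (σ * R : ℝ) * I)) (Ioi C) := by
    refine integrableOn_of_norm_le_exp (M := M * Real.exp (-ε * R)) hε ?_ ?_
    · refine hF.continuousOn.comp (by fun_prop) fun y hy => ?_
      simpa [hσm] using hy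
    · intro y hy
      refine (hb _ (by simpa using hy) (by simp [hσm])).trans (le_of_eq ?_)
      simp [hσm]
  refine ⟨hv, hh, ?_⟩
  have tn : Tendsto (fun n : ℕ => (n : ℝ)) atTop atTop := tendsto_natCast_atTop_atTop
  have l1 := (intervalIntegral_tendsto_integral_Ioi R hv
    (tendsto_atTop_add_const_left _ R tn)).const_mul ((σ : ℂ) * I)
  have l2 := intervalIntegral_tendsto_integral_Ioi C hh (tendsto_atTop_add_const_left _ C tn)
  -- Cauchy's theorem is applied to squares of side n. Each far side has length n and an integrand
  -- of size e^(-εn), so both contributions are at most a constant times n e^(-εn).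
  have hdec : Tendsto (fun n : ℕ => M * Real.exp (-ε * R) * Real.exp (-ε * C) *
      ((n : ℝ) * Real.exp (-ε * n))) atTop (𝓝 0) := by
    have : Tendsto (fun x : ℝ => x * Real.exp (-ε * x)) atTop (𝓝 0) := by
      have h := ((Real.tendsto_pow_mul_exp_neg_atTop_nhds_zero 1).comp
        (tendsto_id.const_mul_atTop hε)).const_mul ε⁻¹
      rw [mul_zero] at h
      refine h.congr fun x => ?_
      simp [field]
    simpa using (this.comp tn).const_mul _
  have far1 : Tendsto (fun n : ℕ => ∫ x in C..(C + n), F ((x : ℂ) + (σ * (R + n) : ℝ) * I))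
      atTop (𝓝 0) := by
    refine squeeze_zero_norm (fun n => ?_) hdec
    have := intervalIntegral.norm_integral_le_of_norm_le_const
      (f := fun x : ℝ => F ((x : ℂ) + (σ * (R + n) : ℝ) * I)) (a := C) (b := C + n)
      (C := M * Real.exp (-ε * (R + n)) * Real.exp (-ε * C)) (fun x hx => by
        rw [uIoc_of_le (by simp)] at hx
        have hM : 0 ≤ M := by
          have := (norm_nonneg _).trans (hb ((C : ℂ) + (σ * R : ℝ) * I) (by simp) (by simp [hσm]))
          by_contra h
          have : M * Real.exp (-ε * (σ * ((C : ℂ) + (σ * R : ℝ) * I).im)) *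
            Real.exp (-ε * ((C : ℂ) + (σ * R : ℝ) * I).re) < 0 :=
            mul_neg_of_neg_of_pos (mul_neg_of_neg_of_pos (not_le.1 h) (Real.exp_pos _))
              (Real.exp_pos _)
          linarith
        refine (hb _ (by simpa using hx.1.le) (by simp [hσm])).trans ?_
        simp only [add_re, ofReal_re, mul_re, I_re, mul_zero, ofReal_im, I_im, mul_one, sub_self,
          add_zero, add_im, mul_im, zero_add, hσm]
        have : -ε * x ≤ -ε * C := by nlinarith [hx.1]
        gcongr)
    refine this.trans (le_of_eq ?_)
    rw [show -ε * (R + n) = -ε * R + -ε * n by ring, Real.exp_add]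
    simp; ring
  have far2 : Tendsto (fun n : ℕ => ∫ y in R..(R + n),
      F (((C + n : ℝ) : ℂ) + (σ * y : ℝ) * I)) atTop (𝓝 0) := by
    refine squeeze_zero_norm (fun n => ?_) hdec
    have := intervalIntegral.norm_integral_le_of_norm_le_const
      (f := fun y : ℝ => F (((C + n : ℝ) : ℂ) + (σ * y : ℝ) * I)) (a := R) (b := R + n)
      (C := M * Real.exp (-ε * R) * Real.exp (-ε * (C + n))) (fun x hx => by
        rw [uIoc_of_le (by simp)] at hx
        have hM : 0 ≤ M := by
          have := (norm_nonneg _).trans (hb ((C : ℂ) + (σ * R : ℝ) * I) (by simp) (by simp [hσm]))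
          by_contra h
          have : M * Real.exp (-ε * (σ * ((C : ℂ) + (σ * R : ℝ) * I).im)) *
            Real.exp (-ε * ((C : ℂ) + (σ * R : ℝ) * I).re) < 0 :=
            mul_neg_of_neg_of_pos (mul_neg_of_neg_of_pos (not_le.1 h) (Real.exp_pos _))
              (Real.exp_pos _)
          linarith
        refine (hb _ (by simp) (by simpa [hσm] using hx.1.le)).trans ?_
        simp only [add_re, ofReal_re, mul_re, I_re, mul_zero, ofReal_im, I_im, mul_one, sub_self,
          add_zero, add_im, mul_im, zero_add, hσm]
        have : -ε * x ≤ -ε * R := by nlinarith [hx.1]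
        gcongr)
    refine this.trans (le_of_eq ?_)
    rw [show -ε * (C + n) = -ε * C + -ε * n by ring, Real.exp_add]
    simp; ring
  have key : ∀ n : ℕ, ((σ : ℂ) * I * ∫ y in R..(R + n), F ((C : ℂ) + (σ * y : ℝ) * I))
      = (∫ x in C..(C + n), F ((x : ℂ) + (σ * R : ℝ) * I))
        - (∫ x in C..(C + n), F ((x : ℂ) + (σ * (R + n) : ℝ) * I))
        + (σ : ℂ) * I * ∫ y in R..(R + n), F (((C + n : ℝ) : ℂ) + (σ * y : ℝ) * I) := by
    intro n
    have hn : (0 : ℝ) ≤ n := Nat.cast_nonneg n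
    have key := Complex.integral_boundary_rect_eq_zero_of_differentiableOn F
      (⟨C, σ * R⟩ : ℂ) (⟨C + n, σ * (R + n)⟩ : ℂ) (hF.mono (by
        rintro s ⟨h1, h2⟩
        simp only [mem_preimage] at h1 h2
        rw [uIcc_of_le (by linarith)] at h1
        refine ⟨h1.1, ?_⟩
        rcases hσ with rfl | rfl
        · rw [uIcc_of_le (by linarith)] at h2
          linarith [h2.1]
        · rw [uIcc_of_ge (by linarith)] at h2
          linarith [h2.2]))
    have sub : ∀ a : ℝ, (∫ y in (σ * R)..(σ * (R + n)), F ((a : ℂ) + (y : ℂ) * I))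
        = (σ : ℂ) * ∫ y in R..(R + n), F ((a : ℂ) + (σ * y : ℝ) * I) := by
      intro a
      have := intervalIntegral.smul_integral_comp_mul_left (a := R) (b := R + n)
        (fun y : ℝ => F ((a : ℂ) + (y : ℂ) * I)) σ
      rw [← this, real_smul]
    simp only [smul_eq_mul, sub] at key
    linear_combination -key
  refine tendsto_nhds_unique l1 ?_
  simp_rw [key]
  simpa using (l2.sub far1).add (far2.const_mul ((σ : ℂ) * I))

/-- The two tails of the line are rotated onto the horizontal rays of the loop; the middle segment
is common to both paths, so F may have poles to the right of it. -/
theorem lineIntegral_eq_loopIntegral {F : ℂ → ℂ} {C R ε M : ℝ} (hε : 0 < ε) (hR : 0 ≤ R)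
    (hF : DifferentiableOn ℂ F {s | C ≤ s.re ∧ R ≤ |s.im|})
    (hc : ContinuousOn F {s | s.re = C})
    (hb : ∀ s : ℂ, C ≤ s.re → R ≤ |s.im| →
      ‖F s‖ ≤ M * Real.exp (-ε * |s.im|) * Real.exp (-ε * s.re)) :
    lineIntegral F C = loopIntegral F C R := by
  obtain ⟨hv, hh, e⟩ := integral_vertical_ray_eq_horizontal (σ := 1) (F := F) (C := C) (R := R)
    (M := M) (Or.inl rfl) hε (hF.mono fun s hs => ⟨hs.1, by
      have := hs.2
      rw [one_mul] at this
      exact this.trans (le_abs_self _)⟩)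
    (fun s h1 h2 => by
      rw [one_mul] at h2 ⊢
      have := hb s h1 (h2.trans (le_abs_self _))
      rwa [abs_of_nonneg (hR.trans h2)] at this)
  obtain ⟨hv', hh', e'⟩ := integral_vertical_ray_eq_horizontal (σ := -1) (F := F) (C := C) (R := R)
    (M := M) (Or.inr rfl) hε (hF.mono fun s hs => ⟨hs.1, by
      have := hs.2
      rw [neg_one_mul] at this
      exact this.trans (neg_le_abs _)⟩)
    (fun s h1 h2 => by
      rw [neg_one_mul] at h2 ⊢
      have := hb s h1 (h2.trans (neg_le_abs _))
      rwa [abs_of_nonpos (by linarith)] at this)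
  simp only [one_mul, ofReal_one, neg_mul, ofReal_neg, ← sub_eq_add_neg] at *
  have hmid : IntervalIntegrable (fun y : ℝ => F ((C : ℂ) + (y : ℂ) * I)) volume (-R) R := by
    refine ContinuousOn.intervalIntegrable (hc.comp (by fun_prop) fun y _ => by simp)
  have hlow : IntegrableOn (fun y : ℝ => F ((C : ℂ) + (y : ℂ) * I)) (Iic (-R)) := by
    rw [integrableOn_Iic_iff_integrableOn_Iio]
    rw [← neg_neg R] at hv'
    simpa using hv'.comp_neg_Iio
  have elow : ∫ y in Ioi R, F ((C : ℂ) - (y : ℂ) * I)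
      = ∫ y in Iic (-R), F ((C : ℂ) + (y : ℂ) * I) := by
    rw [← integral_comp_neg_Ioi]
    simp [← sub_eq_add_neg]
  have hall : (∫ y : ℝ, F ((C : ℂ) + (y : ℂ) * I))
      = (∫ y in Iic (-R), F ((C : ℂ) + (y : ℂ) * I)) + (∫ y in (-R)..R, F ((C : ℂ) + (y : ℂ) * I))
        + ∫ y in Ioi R, F ((C : ℂ) + (y : ℂ) * I) := by
    have hIoi : IntegrableOn (fun y : ℝ => F ((C : ℂ) + (y : ℂ) * I)) (Ioi (-R)) := by
      rw [← Ioc_union_Ioi_eq_Ioi (show -R ≤ R by linarith)]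
      exact ((intervalIntegrable_iff_integrableOn_Ioc_of_le (by linarith)).1 hmid).union hv
    rw [add_assoc, intervalIntegral.integral_interval_add_Ioi hIoi hv,
      intervalIntegral.integral_Iic_add_Ioi hlow hIoi]
  unfold lineIntegral loopIntegral
  rw [hall, ← e, ← e', elow]
  ring

/-! ### Integral representation of the modified Bessel function of the second kind -/

theorem integrable_exp_smul_comp_exp_iff {g : ℝ → ℂ} :
    Integrable (fun u : ℝ => Real.exp u • g (Real.exp u)) ↔ IntegrableOn g (Ioi 0) := by
  have h := integrableOn_image_iff_integrableOn_abs_deriv_smul (f := Real.exp) (f' := Real.exp)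
    (s := univ) MeasurableSet.univ (fun x _ => (Real.hasDerivAt_exp x).hasDerivWithinAt)
    Real.exp_injective.injOn g
  simp only [image_univ, Real.range_exp, integrableOn_univ, Real.abs_exp] at h
  exact h.symm

theorem integral_exp_smul_comp_exp (g : ℝ → ℂ) :
    ∫ u : ℝ, Real.exp u • g (Real.exp u) = ∫ y in Ioi 0, g y := by
  have h := integral_image_eq_integral_abs_deriv_smul (f := Real.exp) (f' := Real.exp)
    (s := univ) MeasurableSet.univ (fun x _ => (Real.hasDerivAt_exp x).hasDerivWithinAt)
    Real.exp_injective.injOn g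
  simp only [image_univ, Real.range_exp, Measure.restrict_univ, Real.abs_exp] at h
  exact h.symm

theorem exp_smul_cpow_mul_exp (c : ℝ) (s : ℂ) (u : ℝ) :
    Real.exp u • (((Real.exp u : ℝ) : ℂ) ^ (-s - 1) * cexp (-((c : ℂ) * (Real.exp u : ℝ))))
      = cexp (-(c * cexp u) - s * u) := by
  rw [real_smul, cpow_def_of_ne_zero (by exact_mod_cast (Real.exp_pos u).ne'),
    ← ofReal_log (Real.exp_pos u).le, Real.log_exp, ofReal_exp, ← Complex.exp_add, ← Complex.exp_add]
  ring_nf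

theorem integrable_exp_neg_mul_exp {c : ℝ} (hc : 0 < c) {s : ℂ} (hs : s.re < 0) :
    Integrable (fun u : ℝ => cexp (-(c * cexp u) - s * u)) := by
  simp_rw [← exp_smul_cpow_mul_exp]
  rw [integrable_exp_smul_comp_exp_iff
    (g := fun y : ℝ => (y : ℂ) ^ (-s - 1) * cexp (-((c : ℂ) * (y : ℂ))))]
  have h := integrableOn_rpow_mul_exp_neg_mul_rpow (s := -s.re - 1) (p := 1) (b := c)
    (by linarith) one_pos hc
  refine h.mono' ?_ ?_
  · refine ContinuousOn.aestronglyMeasurable (fun y hy => ?_) measurableSet_Ioi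
    refine (ContinuousAt.mul ?_ (by fun_prop)).continuousWithinAt
    exact continuousAt_ofReal_cpow_const _ _ (Or.inr (ne_of_gt hy))
  · refine (ae_restrict_iff' measurableSet_Ioi).2 (.of_forall fun y hy => ?_)
    rw [norm_mul, norm_cpow_eq_rpow_re_of_pos hy, Complex.norm_exp]
    simp

theorem integral_exp_neg_mul_exp {c : ℝ} (hc : 0 < c) {s : ℂ} (hs : s.re < 0) :
    ∫ u : ℝ, cexp (-(c * cexp u) - s * u) = (c : ℂ) ^ s * Gamma (-s) := by
  simp_rw [← exp_smul_cpow_mul_exp]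
  rw [integral_exp_smul_comp_exp
    (fun y : ℝ => (y : ℂ) ^ (-s - 1) * cexp (-((c : ℂ) * (y : ℂ)))),
    integral_cpow_mul_exp_neg_mul_Ioi (by simpa using hs) (by simpa using hc)]
  rw [one_div, inv_cpow, cpow_neg, inv_inv]
  rw [arg_ofReal_of_nonneg hc.le]
  exact Real.pi_pos.ne

theorem integrableOn_exp_neg_mul_exp {c : ℝ} (hc : 0 < c) (s : ℂ) (C : ℝ) :
    IntegrableOn (fun u : ℝ => cexp (-(c * cexp u) - s * u)) (Ioi C) := by
  -- Replacing s by s - N moves into the half-plane where the whole-line integral converges; the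
  -- lost factor e^(-Nu) is at most e^(-NC) on the ray.
  obtain ⟨N, hN⟩ := exists_nat_gt s.re
  have h := ((integrable_exp_neg_mul_exp hc (s := s - N) (by simpa using hN)).norm.const_mul
    (Real.exp (-N * C))).integrableOn (s := Ioi C)
  refine h.mono' (Continuous.aestronglyMeasurable (by fun_prop)) ?_
  refine (ae_restrict_iff' measurableSet_Ioi).2 (.of_forall fun u hu => ?_)
  rw [Complex.norm_exp, Complex.norm_exp, ← Real.exp_add, Real.exp_le_exp]
  have : (C : ℝ) < u := hu
  simp
  nlinarith [(Nat.cast_nonneg N : (0 : ℝ) ≤ N)]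

/-! ### Hankel's loop integral for the reciprocal Gamma function, in logarithmic coordinates -/

theorem exp_mul_exp_add_pi (c s : ℂ) (x : ℝ) :
    cexp (c * cexp ((x : ℂ) + (Real.pi : ℂ) * I) - s * ((x : ℂ) + (Real.pi : ℂ) * I))
      = cexp (-(s * (Real.pi * I))) * cexp (-(c * cexp x) - s * x) := by
  rw [Complex.exp_add, exp_pi_mul_I, ← Complex.exp_add]
  ring_nf

theorem exp_mul_exp_sub_pi (c s : ℂ) (x : ℝ) :
    cexp (c * cexp ((x : ℂ) - (Real.pi : ℂ) * I) - s * ((x : ℂ) - (Real.pi : ℂ) * I))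
      = cexp (s * (Real.pi * I)) * cexp (-(c * cexp x) - s * x) := by
  rw [Complex.exp_sub (x : ℂ), exp_pi_mul_I, ← Complex.exp_add]
  ring_nf

theorem integrableOn_hankel_upper {c : ℝ} (hc : 0 < c) (s : ℂ) (C : ℝ) :
    IntegrableOn (fun x : ℝ => cexp (c * cexp ((x : ℂ) + (Real.pi : ℂ) * I)
      - s * ((x : ℂ) + (Real.pi : ℂ) * I))) (Ioi C) := by
  simp_rw [exp_mul_exp_add_pi]
  exact (integrableOn_exp_neg_mul_exp hc s C).const_mul _

theorem integrableOn_hankel_lower {c : ℝ} (hc : 0 < c) (s : ℂ) (C : ℝ) :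
    IntegrableOn (fun x : ℝ => cexp (c * cexp ((x : ℂ) - (Real.pi : ℂ) * I)
      - s * ((x : ℂ) - (Real.pi : ℂ) * I))) (Ioi C) := by
  simp_rw [exp_mul_exp_sub_pi]
  exact (integrableOn_exp_neg_mul_exp hc s C).const_mul _

/-- Pushing the vertical side to -∞ kills it, because Re s < 0. Both rays become Euler's integral
for Γ(-s), with phases e^(∓iπs); their difference produces sin πs, and the reflection formula turns
Γ(-s) sin πs into 1/Γ(s+1). -/
theorem hankel_of_re_neg {c : ℝ} (hc : 0 < c) {s : ℂ} (hs : s.re < 0) :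
    loopIntegral (fun w => cexp (c * cexp w - s * w)) 0 Real.pi = (c : ℂ) ^ s / Gamma (s + 1) := by
  have hshift : ∀ n : ℕ, loopIntegral (fun w => cexp (c * cexp w - s * w)) 0 Real.pi
      = loopIntegral (fun w => cexp (c * cexp w - s * w)) (-n : ℝ) Real.pi := fun n =>
    (loopIntegral_shift (by simp) Real.pi_pos.le (by fun_prop)
      (integrableOn_hankel_upper hc s _) (integrableOn_hankel_lower hc s _)).symm
  have tn : Tendsto (fun n : ℕ => -(n : ℝ)) atTop atBot :=
    tendsto_neg_atTop_atBot.comp tendsto_natCast_atTop_atTop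
  have ray : Tendsto (fun n : ℕ => ∫ u in Ioi (-n : ℝ), cexp (-(c * cexp u) - s * u)) atTop
      (𝓝 ((c : ℂ) ^ s * Gamma (-s))) := by
    rw [← integral_exp_neg_mul_exp hc hs]
    exact (aecover_Ioi tn).integral_tendsto_of_countably_generated
      (integrable_exp_neg_mul_exp hc hs)
  have vert : Tendsto (fun n : ℕ => ∫ y in (-Real.pi)..Real.pi,
      cexp (c * cexp (((-n : ℝ) : ℂ) + (y : ℂ) * I) - s * (((-n : ℝ) : ℂ) + (y : ℂ) * I))) atTop
      (𝓝 0) := by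
    have hdec : Tendsto (fun n : ℕ => Real.exp (s.re * n + (c + |s.im| * Real.pi)) *
        |Real.pi - -Real.pi|) atTop (𝓝 0) := by
      rw [← zero_mul (|Real.pi - -Real.pi|)]
      refine (Real.tendsto_exp_atBot.comp ?_).mul_const _
      exact tendsto_atBot_add_const_right _ _
        (tendsto_natCast_atTop_atTop.const_mul_atTop_of_neg hs)
    refine squeeze_zero_norm (fun n => ?_) hdec
    refine intervalIntegral.norm_integral_le_of_norm_le_const fun y hy => ?_
    rw [uIoc_of_le (by linarith [Real.pi_pos])] at hy
    rw [Complex.norm_exp, Real.exp_le_exp]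
    have h1 : (c * cexp (((-n : ℝ) : ℂ) + (y : ℂ) * I)).re ≤ c := by
      refine (re_le_norm _).trans ?_
      rw [norm_mul, Complex.norm_exp, norm_real, Real.norm_of_nonneg hc.le]
      have : Real.exp ((((-n : ℝ) : ℂ) + (y : ℂ) * I).re) ≤ 1 := by
        rw [Real.exp_le_one_iff]; simp
      nlinarith
    have h2 : s.im * y ≤ |s.im| * Real.pi := by
      have hy' : |y| ≤ Real.pi := abs_le.2 ⟨hy.1.le, hy.2⟩
      calc s.im * y ≤ |s.im * y| := le_abs_self _
        _ = |s.im| * |y| := abs_mul _ _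
        _ ≤ _ := by gcongr
    rw [sub_re]
    have h3 : (s * (((-n : ℝ) : ℂ) + (y : ℂ) * I)).re = -(s.re * n) - s.im * y := by simp
    rw [h3]; linarith
  have lim : Tendsto (fun n : ℕ => loopIntegral (fun w => cexp (c * cexp w - s * w)) (-n : ℝ)
      Real.pi) atTop (𝓝 ((2 * (Real.pi : ℂ) * I)⁻¹ *
        (-(cexp (s * (Real.pi * I)) * ((c : ℂ) ^ s * Gamma (-s))) + I * 0
          + cexp (-(s * (Real.pi * I))) * ((c : ℂ) ^ s * Gamma (-s))))) := by
    unfold loopIntegral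
    simp_rw [exp_mul_exp_add_pi, exp_mul_exp_sub_pi, integral_const_mul]
    exact (((ray.const_mul _).neg.add (vert.const_mul I)).add (ray.const_mul _)).const_mul _
  have := tendsto_nhds_unique (tendsto_const_nhds.congr hshift) lim
  rw [this]
  have hrefl := Complex.Gamma_mul_Gamma_one_sub (-s)
  rw [sub_neg_eq_add, add_comm 1 s, mul_neg, Complex.sin_neg] at hrefl
  have hsin : cexp (-(s * (Real.pi * I))) - cexp (s * (Real.pi * I))
      = -2 * I * Complex.sin (Real.pi * s) := by
    rw [Complex.sin]
    have : I * I = -1 := I_mul_I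
    rw [show -(↑Real.pi * s) * I = -(s * (↑Real.pi * I)) by ring,
      show (↑Real.pi * s) * I = (s * (↑Real.pi * I)) by ring]
    linear_combination (cexp (-(s * (Real.pi * I))) - cexp (s * (Real.pi * I))) * this
  have hpi : (Real.pi : ℂ) ≠ 0 := by exact_mod_cast Real.pi_ne_zero
  have e : (2 * (Real.pi : ℂ) * I)⁻¹ *
        (-(cexp (s * (Real.pi * I)) * ((c : ℂ) ^ s * Gamma (-s))) + I * 0
          + cexp (-(s * (Real.pi * I))) * ((c : ℂ) ^ s * Gamma (-s)))
      = -((c : ℂ) ^ s * Gamma (-s) * Complex.sin (Real.pi * s)) / Real.pi := by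
    rw [show (-(cexp (s * (Real.pi * I)) * ((c : ℂ) ^ s * Gamma (-s))) + I * 0
          + cexp (-(s * (Real.pi * I))) * ((c : ℂ) ^ s * Gamma (-s)))
      = (cexp (-(s * (Real.pi * I))) - cexp (s * (Real.pi * I))) * ((c : ℂ) ^ s * Gamma (-s)) by
        ring, hsin]
    have := I_ne_zero
    field_simp
  rw [e]
  have hG : Gamma (-s) ≠ 0 := Gamma_ne_zero_of_re_pos (by simpa using hs)
  -- If sin πs = 0, the reflection formula reads Γ(-s) Γ(s+1) = π/0 = 0, so Γ(s+1) has its default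
  -- value 0 and both sides of the goal vanish.
  by_cases h0 : Complex.sin (Real.pi * s) = 0
  · rw [h0] at hrefl
    have : Gamma (s + 1) = 0 := by simpa [hG] using hrefl
    simp [h0, this]
  · have hG1 : Gamma (s + 1) ≠ 0 := by
      intro h
      rw [h, mul_zero] at hrefl
      exact (div_ne_zero hpi (neg_ne_zero.2 h0)) hrefl.symm
    rw [eq_div_iff (neg_ne_zero.2 h0)] at hrefl
    rw [div_eq_div_iff hpi hG1]
    linear_combination (c : ℂ) ^ s * hrefl

/-- The fundamental theorem of calculus on each side: the corner values cancel, and F tends to 0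
along the rays because F and F' are integrable there. -/
theorem loopIntegral_eq_zero_of_hasDerivAt {F F' : ℂ → ℂ} {C R : ℝ}
    (hF : ∀ s, HasDerivAt F (F' s) s) (hc : Continuous F')
    (hu : IntegrableOn (fun x : ℝ => F ((x : ℂ) + (R : ℂ) * I)) (Ioi C))
    (hl : IntegrableOn (fun x : ℝ => F ((x : ℂ) - (R : ℂ) * I)) (Ioi C))
    (hu' : IntegrableOn (fun x : ℝ => F' ((x : ℂ) + (R : ℂ) * I)) (Ioi C))
    (hl' : IntegrableOn (fun x : ℝ => F' ((x : ℂ) - (R : ℂ) * I)) (Ioi C)) :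
    loopIntegral F' C R = 0 := by
  have du : ∀ x : ℝ, HasDerivAt (fun x : ℝ => F ((x : ℂ) + (R : ℂ) * I))
      (F' ((x : ℂ) + (R : ℂ) * I)) x := fun x => by
    have := (hF ((x : ℂ) + (R : ℂ) * I)).scomp x ((ofRealCLM.hasDerivAt (x := x)).add_const (R * I))
    simpa [Function.comp_def] using this
  have dl : ∀ x : ℝ, HasDerivAt (fun x : ℝ => F ((x : ℂ) - (R : ℂ) * I))
      (F' ((x : ℂ) - (R : ℂ) * I)) x := fun x => by
    have := (hF ((x : ℂ) - (R : ℂ) * I)).scomp x ((ofRealCLM.hasDerivAt (x := x)).sub_const (R * I))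
    simpa [Function.comp_def] using this
  have dv : ∀ y : ℝ, HasDerivAt (fun y : ℝ => F ((C : ℂ) + (y : ℂ) * I))
      (I * F' ((C : ℂ) + (y : ℂ) * I)) y := fun y => by
    have := (hF ((C : ℂ) + (y : ℂ) * I)).scomp y
      (((ofRealCLM.hasDerivAt (x := y)).mul_const I).const_add (C : ℂ))
    simpa [Function.comp_def] using this
  have tu := tendsto_zero_of_hasDerivAt_of_integrableOn_Ioi (fun x _ => du x) hu' hu
  have tl := tendsto_zero_of_hasDerivAt_of_integrableOn_Ioi (fun x _ => dl x) hl' hl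
  have eu := integral_Ioi_of_hasDerivAt_of_tendsto' (fun x _ => du x) hu' tu
  have el := integral_Ioi_of_hasDerivAt_of_tendsto' (fun x _ => dl x) hl' tl
  have ev := intervalIntegral.integral_eq_sub_of_hasDerivAt (a := -R) (b := R) (fun y _ => dv y)
    (Continuous.intervalIntegrable (by fun_prop) _ _)
  rw [intervalIntegral.integral_const_mul] at ev
  unfold loopIntegral
  rw [eu, el, ev]
  simp [← sub_eq_add_neg]

/-- The difference of the two sides is the loop integral of the derivative of exp(c e^w - s w). This
mirrors Γ(s+1) = s Γ(s) and carries Hankel's formula to the right. -/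
theorem hankel_recurrence {c : ℝ} (hc : 0 < c) (s : ℂ) :
    c * loopIntegral (fun w => cexp (c * cexp w - (s - 1) * w)) 0 Real.pi
      = s * loopIntegral (fun w => cexp (c * cexp w - s * w)) 0 Real.pi := by
  have hd : ∀ w, HasDerivAt (fun w => cexp (c * cexp w - s * w))
      (c * cexp (c * cexp w - (s - 1) * w) - s * cexp (c * cexp w - s * w)) w := fun w => by
    have h := (((Complex.hasDerivAt_exp w).const_mul (c : ℂ)).sub
      ((hasDerivAt_id w).const_mul s)).cexp
    refine HasDerivAt.congr_deriv h ?_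
    simp only [id, mul_one, Pi.sub_apply]
    rw [show c * cexp w - (s - 1) * w = (c * cexp w - s * w) + w by ring, Complex.exp_add]
    ring
  have u1 := (integrableOn_hankel_upper hc (s - 1) 0).const_mul (c : ℂ)
  have u2 := (integrableOn_hankel_upper hc s 0).const_mul s
  have l1 := (integrableOn_hankel_lower hc (s - 1) 0).const_mul (c : ℂ)
  have l2 := (integrableOn_hankel_lower hc s 0).const_mul s
  have := loopIntegral_eq_zero_of_hasDerivAt (C := 0) (R := Real.pi) hd (by fun_prop)
    (integrableOn_hankel_upper hc s 0) (integrableOn_hankel_lower hc s 0)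
    (u1.sub u2) (l1.sub l2)
  unfold loopIntegral at this ⊢
  rw [integral_sub u1 u2, integral_sub l1 l2, intervalIntegral.integral_sub
    (Continuous.intervalIntegrable (by fun_prop) _ _)
    (Continuous.intervalIntegrable (by fun_prop) _ _)] at this
  simp only [integral_const_mul, intervalIntegral.integral_const_mul] at this
  linear_combination this

/-- Hankel's integral for the reciprocal Gamma function. -/
theorem hankel {c : ℝ} (hc : 0 < c) {s : ℂ} (hs : ∀ k : ℤ, s ≠ k) :
    loopIntegral (fun w => cexp (c * cexp w - s * w)) 0 Real.pi = (c : ℂ) ^ s / Gamma (s + 1) := by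
  obtain ⟨n, hn⟩ := exists_nat_gt s.re
  induction n generalizing s with
  | zero => exact hankel_of_re_neg hc (by simpa using hn)
  | succ n ih =>
    have h1 := ih (s := s - 1) (fun k hk => hs (k + 1) (by push_cast; rw [← hk]; ring)) (by
      push_cast at hn
      simp only [sub_re, one_re]; linarith)
    have h2 := hankel_recurrence hc s
    have hs0 : s ≠ 0 := by simpa using hs 0
    have hc0 : (c : ℂ) ≠ 0 := by exact_mod_cast hc.ne'
    rw [h1, sub_add_cancel] at h2
    have hG : Gamma s ≠ 0 := Gamma_ne_zero fun m hm => hs (-m) (by push_cast; exact hm)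
    rw [Gamma_add_one s hs0]
    rw [cpow_sub _ _ hc0, cpow_one] at h2
    rw [eq_div_iff (mul_ne_zero hs0 hG), ← mul_assoc, mul_comm _ s, ← h2]
    field_simp

/-- Termwise integration of the exponential series, dominated by ‖a‖^k/k! times the L¹ norm of g. -/
theorem hasSum_integral_exp_mul {α : Type*} [MeasurableSpace α] {ρ : Measure α} {g h : α → ℂ}
    (hg : Integrable g ρ) (hh : AEStronglyMeasurable h ρ) (hb : ∀ᵐ x ∂ρ, ‖h x‖ ≤ 1) (a : ℂ) :
    HasSum (fun k : ℕ => a ^ k / (k.factorial : ℂ) * ∫ x, h x ^ k * g x ∂ρ)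
      (∫ x, cexp (a * h x) * g x ∂ρ) := by
  have hi : ∀ k : ℕ, Integrable (fun x => h x ^ k * g x) ρ := fun k => by
    refine hg.bdd_mul (c := 1) (hh.pow k) ?_
    filter_upwards [hb] with x hx
    rw [norm_pow]
    exact pow_le_one₀ (norm_nonneg _) hx
  have key := hasSum_integral_of_summable_integral_norm (μ := ρ)
    (F := fun k x => a ^ k / (k.factorial : ℂ) * (h x ^ k * g x)) (fun k => (hi k).const_mul _) (by
      refine Summable.of_nonneg_of_le (fun k => integral_nonneg fun x => norm_nonneg _) (fun k => ?_)
        ((Real.summable_pow_div_factorial ‖a‖).mul_right (∫ x, ‖g x‖ ∂ρ))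
      simp only [norm_mul, norm_div, norm_pow, Complex.norm_natCast, integral_const_mul]
      gcongr ?_ * ?_
      refine integral_mono_of_nonneg (.of_forall fun x => by positivity) hg.norm ?_
      filter_upwards [hb] with x hx
      exact mul_le_of_le_one_left (norm_nonneg _) (pow_le_one₀ (norm_nonneg _) hx))
  simp only [integral_const_mul] at key
  have e : ∀ x, ∑' k : ℕ, a ^ k / (k.factorial : ℂ) * (h x ^ k * g x) = cexp (a * h x) * g x := by
    intro x
    rw [Complex.exp_eq_exp_ℂ,
      ← ((NormedSpace.expSeries_div_hasSum_exp (𝔸 := ℂ) (a * h x)).mul_right (g x)).tsum_eq]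
    refine tsum_congr fun k => ?_
    rw [mul_pow]; ring
  simpa only [e] using key

/-! ### Schläfli's integral for I and the cosh integral for K -/

theorem exp_cosh_eq_mul (t ν w : ℂ) : cexp (t * cosh w - ν * w)
    = cexp (t / 2 * cexp (-w)) * cexp (t / 2 * cexp w - ν * w) := by
  rw [← Complex.exp_add, cosh]
  ring_nf

theorem exp_neg_pow_mul (c ν w : ℂ) (k : ℕ) : cexp (-w) ^ k * cexp (c * cexp w - ν * w)
    = cexp (c * cexp w - (ν + k) * w) := by
  rw [← Complex.exp_nat_mul, ← Complex.exp_add]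
  ring_nf

/-- Schläfli's integral for the modified Bessel function of the first kind. -/
theorem besselI_eq_loopIntegral {t : ℝ} (ht : 0 < t) {ν : ℂ} (hν : ∀ k : ℤ, ν ≠ k) :
    besselI ν t = loopIntegral (fun w => cexp (t * cosh w - ν * w)) 0 Real.pi := by
  -- The loop lies in Re w ≥ 0, where |e^(-w)| ≤ 1, so exp((t/2) e^(-w)) can be expanded termwise
  -- against Hankel's integrand with c = t/2. Each factor e^(-kw) shifts the order from ν to ν + k.
  have hc : 0 < t / 2 := by positivity
  have hI : ∀ {w : ℂ}, 0 ≤ w.re → ‖cexp (-w)‖ ≤ 1 := fun {w} hw => by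
    rw [Complex.norm_exp]; simpa using hw
  have hu := hasSum_integral_exp_mul (h := fun x : ℝ => cexp (-((x : ℂ) + (Real.pi : ℂ) * I)))
    (integrableOn_hankel_upper hc ν 0) (Continuous.aestronglyMeasurable (by fun_prop))
    ((ae_restrict_iff' measurableSet_Ioi).2 (.of_forall fun x hx => hI (by simpa using hx.le)))
    ((t / 2 : ℝ) : ℂ)
  have hl := hasSum_integral_exp_mul (h := fun x : ℝ => cexp (-((x : ℂ) - (Real.pi : ℂ) * I)))
    (integrableOn_hankel_lower hc ν 0) (Continuous.aestronglyMeasurable (by fun_prop))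
    ((ae_restrict_iff' measurableSet_Ioi).2 (.of_forall fun x hx => hI (by simpa using hx.le)))
    ((t / 2 : ℝ) : ℂ)
  have hv := hasSum_integral_exp_mul (ρ := volume.restrict (Ioc (-Real.pi) Real.pi))
    (h := fun y : ℝ => cexp (-(((0 : ℝ) : ℂ) + (y : ℂ) * I)))
    (g := fun y : ℝ => cexp ((t / 2 : ℝ) * cexp (((0 : ℝ) : ℂ) + (y : ℂ) * I)
      - ν * (((0 : ℝ) : ℂ) + (y : ℂ) * I)))
    (Continuous.integrableOn_Ioc (by fun_prop)) (Continuous.aestronglyMeasurable (by fun_prop))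
    (.of_forall fun x => hI (by simp)) ((t / 2 : ℝ) : ℂ)
  simp only [exp_neg_pow_mul] at hu hl hv
  have hall := ((hl.neg.add (hv.mul_left I)).add hu).mul_left (2 * (Real.pi : ℂ) * I)⁻¹
  have hterm : ∀ k : ℕ, (2 * (Real.pi : ℂ) * I)⁻¹ *
      (-(((t / 2 : ℝ) : ℂ) ^ k / (k.factorial : ℂ) *
        ∫ x : ℝ in Ioi 0, cexp ((t / 2 : ℝ) * cexp ((x : ℂ) - (Real.pi : ℂ) * I)
          - (ν + k) * ((x : ℂ) - (Real.pi : ℂ) * I)))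
        + I * (((t / 2 : ℝ) : ℂ) ^ k / (k.factorial : ℂ) *
        ∫ y : ℝ in Ioc (-Real.pi) Real.pi, cexp ((t / 2 : ℝ) * cexp (((0 : ℝ) : ℂ) + (y : ℂ) * I)
          - (ν + k) * (((0 : ℝ) : ℂ) + (y : ℂ) * I)))
        + ((t / 2 : ℝ) : ℂ) ^ k / (k.factorial : ℂ) *
        ∫ x : ℝ in Ioi 0, cexp ((t / 2 : ℝ) * cexp ((x : ℂ) + (Real.pi : ℂ) * I)
          - (ν + k) * ((x : ℂ) + (Real.pi : ℂ) * I)))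
      = ((t : ℂ) / 2) ^ (ν + 2 * (k : ℂ)) / ((k.factorial : ℂ) * Gamma (ν + (k : ℂ) + 1)) := by
    intro k
    have h := hankel hc (s := ν + k) (fun m hm => hν (m - k) (by push_cast; rw [← hm]; ring))
    unfold loopIntegral at h
    rw [intervalIntegral.integral_of_le (by linarith [Real.pi_pos])] at h
    have hc0 : ((t / 2 : ℝ) : ℂ) ≠ 0 := by exact_mod_cast hc.ne'
    have e : ((t : ℂ) / 2) ^ (ν + 2 * (k : ℂ))
        = ((t / 2 : ℝ) : ℂ) ^ k * ((t / 2 : ℝ) : ℂ) ^ (ν + k) := by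
      rw [show ν + 2 * (k : ℂ) = k + (ν + k) by ring, show (t : ℂ) / 2 = ((t / 2 : ℝ) : ℂ) by simp,
        cpow_add _ _ hc0, cpow_natCast]
    rw [e, mul_div_mul_comm, ← h]
    ring
  unfold besselI loopIntegral
  simp_rw [exp_cosh_eq_mul]
  rw [intervalIntegral.integral_of_le (by linarith [Real.pi_pos])]
  rw [tsum_congr fun k => (hterm k).symm, hall.tsum_eq]
  simp

/-- On u > 0, cosh u ≥ e^u/2 reduces the claim to the Euler integrand with c = t/2; the reflection u
↦ -u, which negates ν, handles the other half-line. -/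
theorem integrable_exp_neg_cosh {t : ℝ} (ht : 0 < t) (ν : ℂ) :
    Integrable (fun u : ℝ => cexp (-(t * cosh u) - ν * u)) := by
  have hpos : ∀ ν : ℂ, IntegrableOn (fun u : ℝ => cexp (-(t * cosh u) - ν * u)) (Ioi 0) := by
    intro ν
    refine (integrableOn_exp_neg_mul_exp (half_pos ht) ν 0).norm.mono'
      (Continuous.aestronglyMeasurable (by fun_prop)) (.of_forall fun u => ?_)
    rw [Complex.norm_exp, Complex.norm_exp, Real.exp_le_exp, sub_re, sub_re]
    have h1 : (-(t * cosh (u : ℂ))).re = -(t * Real.cosh u) := by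
      rw [← ofReal_cosh, ← ofReal_mul, ← ofReal_neg, ofReal_re]
    have h2 : (-(((t / 2 : ℝ) : ℂ) * cexp (u : ℂ))).re = -(t / 2 * Real.exp u) := by
      rw [← ofReal_exp, ← ofReal_mul, ← ofReal_neg, ofReal_re]
    rw [h1, h2, Real.cosh_eq]
    nlinarith [Real.exp_pos (-u)]
  rw [← integrableOn_univ, ← Iic_union_Ioi (a := (0 : ℝ)), integrableOn_union]
  refine ⟨?_, hpos ν⟩
  rw [integrableOn_Iic_iff_integrableOn_Iio]
  have h := hpos (-ν)
  rw [← neg_zero] at h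
  simpa [cosh_neg] using h.comp_neg_Iio

/-- In Schläfli's integrals for the orders ν and -ν the vertical sides agree under y ↦ -y and
cancel. On Im w = ±π, cosh w = -cosh (Re w), so the phases of the rays combine to sin πν, which the
quotient removes; the two half-line integrals left form one over ℝ. -/
theorem besselKQuot_eq_integral {t : ℝ} (ht : 0 < t) {ν : ℂ} (hν : ∀ k : ℤ, ν ≠ k) :
    besselKQuot ν t = 1 / 2 * ∫ u : ℝ, cexp (-(t * cosh u) - ν * u) := by
  have hpi : (Real.pi : ℂ) ≠ 0 := by exact_mod_cast Real.pi_ne_zero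
  have hν' : ∀ k : ℤ, -ν ≠ k := fun k hk => hν (-k) (by push_cast; rw [← hk, neg_neg])
  have hsin : sin ((Real.pi : ℂ) * ν) ≠ 0 := by
    rw [Complex.sin_ne_zero_iff]
    intro k hk
    exact hν k (mul_left_cancel₀ hpi (by rw [hk]; ring))
  have eu : ∀ (ν : ℂ) (x : ℝ), cexp (t * cosh ((x : ℂ) + (Real.pi : ℂ) * I)
      - ν * ((x : ℂ) + (Real.pi : ℂ) * I)) = cexp (-(ν * (Real.pi * I))) *
        cexp (-(t * cosh x) - ν * x) := fun ν x => by
    rw [cosh_add_pi_mul_I, ← Complex.exp_add]; ring_nf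
  have el : ∀ (ν : ℂ) (x : ℝ), cexp (t * cosh ((x : ℂ) - (Real.pi : ℂ) * I)
      - ν * ((x : ℂ) - (Real.pi : ℂ) * I)) = cexp (ν * (Real.pi * I)) *
        cexp (-(t * cosh x) - ν * x) := fun ν x => by
    rw [cosh_sub_pi_mul_I, ← Complex.exp_add]; ring_nf
  have ev : (∫ y in (-Real.pi)..Real.pi, cexp (t * cosh (((0 : ℝ) : ℂ) + (y : ℂ) * I)
      - -ν * (((0 : ℝ) : ℂ) + (y : ℂ) * I)))
      = ∫ y in (-Real.pi)..Real.pi, cexp (t * cosh (((0 : ℝ) : ℂ) + (y : ℂ) * I)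
      - ν * (((0 : ℝ) : ℂ) + (y : ℂ) * I)) := by
    have := intervalIntegral.integral_comp_neg (a := -Real.pi) (b := Real.pi)
      (fun y : ℝ => cexp (t * cosh (((0 : ℝ) : ℂ) + (y : ℂ) * I)
      - ν * (((0 : ℝ) : ℂ) + (y : ℂ) * I)))
    rw [neg_neg] at this
    rw [← this]
    congr 1
    ext y
    simp [cosh_neg]
  have esplit : (∫ u : ℝ, cexp (-(t * cosh u) - ν * u))
      = (∫ u : ℝ in Ioi 0, cexp (-(t * cosh u) - -ν * u))
        + ∫ u : ℝ in Ioi 0, cexp (-(t * cosh u) - ν * u) := by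
    have hi := integrable_exp_neg_cosh ht ν
    rw [← intervalIntegral.integral_Iic_add_Ioi (b := 0) hi.integrableOn hi.integrableOn]
    congr 1
    rw [← neg_zero, ← integral_comp_neg_Ioi]
    simp [cosh_neg]
  rw [esplit, besselKQuot, besselI_eq_loopIntegral ht hν, besselI_eq_loopIntegral ht hν']
  unfold loopIntegral
  simp only [ev, eu, el, integral_const_mul]
  have hs : cexp (-(ν * (Real.pi * I))) - cexp (ν * (Real.pi * I))
      = -2 * I * Complex.sin (Real.pi * ν) := by
    rw [Complex.sin]
    have : I * I = -1 := I_mul_I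
    rw [show -(↑Real.pi * ν) * I = -(ν * (↑Real.pi * I)) by ring,
      show (↑Real.pi * ν) * I = (ν * (↑Real.pi * I)) by ring]
    linear_combination (cexp (-(ν * (Real.pi * I))) - cexp (ν * (Real.pi * I))) * this
  have hs' : cexp (ν * (Real.pi * I)) = cexp (-(ν * (Real.pi * I)))
      + 2 * I * Complex.sin (Real.pi * ν) := by linear_combination -hs
  have := I_ne_zero
  simp only [neg_mul, neg_neg]
  rw [hs']
  field_simp
  ring

theorem continuous_integral_exp_neg_cosh {t : ℝ} (ht : 0 < t) :
    Continuous (fun ν : ℂ => ∫ u : ℝ, cexp (-(t * cosh u) - ν * u)) := by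
  rw [continuous_iff_continuousAt]
  intro ν₀
  -- For |Re ν| < |Re ν₀| + 1 the integrand is dominated by the one of order -(|Re ν₀| + 1) for u ≥
  -- 0 and of order |Re ν₀| + 1 for u ≤ 0; the sum covers both.
  refine continuousAt_of_dominated (bound := fun u : ℝ =>
    ‖cexp (-(t * cosh u) - ((|ν₀.re| + 1 : ℝ) : ℂ) * u)‖
      + ‖cexp (-(t * cosh u) - ((-(|ν₀.re| + 1) : ℝ) : ℂ) * u)‖)
    (.of_forall fun ν => Continuous.aestronglyMeasurable (by fun_prop)) ?_
    ((integrable_exp_neg_cosh ht _).norm.add (integrable_exp_neg_cosh ht _).norm)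
    (.of_forall fun u => by fun_prop)
  have : ∀ᶠ ν : ℂ in 𝓝 ν₀, |ν.re| < |ν₀.re| + 1 :=
    (continuous_re.abs.continuousAt (x := ν₀)).eventually_lt continuousAt_const (by linarith)
  filter_upwards [this] with ν hν
  refine .of_forall fun u => ?_
  simp only [Complex.norm_exp, sub_re]
  have e : ∀ z : ℂ, (z * (u : ℂ)).re = z.re * u := fun z => by simp
  simp only [e, ofReal_re]
  have h := abs_lt.1 hν
  rcases le_total 0 u with hu | hu
  · refine le_add_of_nonneg_of_le (Real.exp_pos _).le (Real.exp_le_exp.2 ?_)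
    nlinarith [h.1]
  · refine le_add_of_le_of_nonneg (Real.exp_le_exp.2 ?_) (Real.exp_pos _).le
    nlinarith [h.2]

theorem besselK_eq_integral {t : ℝ} (ht : 0 < t) (ν : ℂ) :
    besselK ν t = 1 / 2 * ∫ u : ℝ, cexp (-(t * cosh u) - ν * u) := by
  unfold besselK
  split_ifs with h
  · obtain ⟨k, rfl⟩ := h
    have h1 : Tendsto (fun ν : ℂ => 1 / 2 * ∫ u : ℝ, cexp (-(t * cosh u) - ν * u)) (𝓝[≠] (k : ℂ))
        (𝓝 (1 / 2 * ∫ u : ℝ, cexp (-(t * cosh u) - k * u))) :=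
      (((continuous_integral_exp_neg_cosh ht).tendsto _).mono_left nhdsWithin_le_nhds).const_mul _
    refine (h1.congr' ?_).limUnder_eq
    -- The punctured unit disc about k contains no integer, so the formula for non-integral orders
    -- applies throughout it.
    have : ∀ᶠ ν : ℂ in 𝓝[≠] (k : ℂ), ν ∈ Metric.ball (k : ℂ) 1 :=
      nhdsWithin_le_nhds (Metric.ball_mem_nhds _ one_pos)
    filter_upwards [this, self_mem_nhdsWithin] with ν h2 h3
    refine (besselKQuot_eq_integral ht fun m hm => h3 ?_).symm
    subst hm
    rw [Metric.mem_ball, dist_eq, ← Int.cast_sub, Complex.norm_intCast] at h2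
    have : |m - k| < 1 := by exact_mod_cast h2
    have : m = k := by rw [Int.abs_lt_one_iff] at this; omega
    simp [this]
  · push Not at h
    exact besselKQuot_eq_integral ht h

/-! ### The Mellin transform of the modified Bessel function of the second kind -/

theorem hasMellin_exp_neg_mul_sq {b : ℝ} (hb : 0 < b) {z : ℂ} (hz : 0 < z.re) :
    HasMellin (fun t : ℝ => cexp (-(b * (t : ℂ) ^ 2))) z
      (1 / 2 * ((1 / b : ℂ) ^ (z / 2) * Gamma (z / 2))) := by
  have hz2 : 0 < (z / 2).re := by simpa using hz
  have hz2' : (z / (2 : ℝ)) = z / 2 := by simp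
  have hconv : MellinConvergent (fun t : ℝ => cexp (-((b : ℂ) * t))) (z / (2 : ℝ)) := by
    rw [hz2']
    have h := integrableOn_rpow_mul_exp_neg_mul_rpow (s := (z / 2).re - 1) (p := 1) (b := b)
      (by linarith) one_pos hb
    refine h.mono' ?_ ?_
    · simp only [smul_eq_mul]
      refine ContinuousOn.aestronglyMeasurable (fun y hy => ?_) measurableSet_Ioi
      refine (ContinuousAt.mul ?_ (by fun_prop)).continuousWithinAt
      exact continuousAt_ofReal_cpow_const _ _ (Or.inr (ne_of_gt hy))
    · refine (ae_restrict_iff' measurableSet_Ioi).2 (.of_forall fun y hy => ?_)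
      rw [norm_smul, norm_cpow_eq_rpow_re_of_pos hy, Complex.norm_exp]
      simp
  have e : ∀ t : ℝ, cexp (-((b : ℂ) * ((t ^ (2 : ℝ) : ℝ) : ℂ))) = cexp (-(b * (t : ℂ) ^ 2)) :=
    fun t => by rw [Real.rpow_two, ofReal_pow]
  have h1 := (MellinConvergent.comp_rpow (a := 2) two_ne_zero).2 hconv
  have h2 := mellin_comp_rpow (fun t : ℝ => cexp (-((b : ℂ) * t))) z 2
  simp only [e] at h1 h2
  refine ⟨h1, ?_⟩
  rw [h2, hz2', mellin]
  simp only [smul_eq_mul]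
  rw [integral_cpow_mul_exp_neg_mul_Ioi hz2 (by simpa using hb)]
  simp

/-- The integrand of a double integral for the Mellin transform of the Bessel function. -/
noncomputable def besselMellinKernel (μ w : ℂ) (t u : ℝ) : ℂ :=
  (t : ℂ) ^ (w + μ - 1) * cexp (-((Real.exp (-u) / 4 : ℝ) * (t : ℂ) ^ 2))
    * cexp (-(cexp u) - μ * u)

/-- The translation u ↦ u - log(t/2) turns t cosh u into e^u + t² e^(-u)/4, so that t occurs only in
a power and a Gaussian. -/
theorem besselK_eq_integral_besselMellinKernel {t : ℝ} (ht : 0 < t) (μ w : ℂ) :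
    (t : ℂ) ^ (w - 1) * besselK μ t
      = (2 : ℂ) ^ (-μ - 1) * ∫ u : ℝ, besselMellinKernel μ w t u := by
  have ht0 : (t : ℂ) ≠ 0 := by exact_mod_cast ht.ne'
  rw [besselK_eq_integral ht,
    ← integral_sub_right_eq_self (fun u : ℝ => cexp (-(t * cosh u) - μ * u)) (Real.log (t / 2)),
    ← mul_assoc, ← integral_const_mul, ← integral_const_mul]
  congr 1
  ext u
  have h2 : (2 : ℂ) ^ (-μ - 1) = cexp (-μ * Real.log 2) / 2 := by
    rw [cpow_sub _ _ two_ne_zero, cpow_one, cpow_def_of_ne_zero two_ne_zero,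
      show (2 : ℂ) = ((2 : ℝ) : ℂ) by simp, ofReal_log zero_le_two]
    ring_nf
  have h3 : (t : ℂ) ^ (w + μ - 1) = (t : ℂ) ^ (w - 1) * cexp (μ * Real.log t) := by
    rw [show w + μ - 1 = (w - 1) + μ by ring, cpow_add _ _ ht0, cpow_def_of_ne_zero ht0 μ,
      ofReal_log ht.le, mul_comm (log _)]
  have h4 : (t : ℂ) * cosh ((u - Real.log (t / 2) : ℝ) : ℂ)
      = cexp u + (Real.exp (-u) / 4 : ℝ) * (t : ℂ) ^ 2 := by
    rw [← ofReal_cosh, Real.cosh_eq, neg_sub, Real.exp_sub, Real.exp_sub, Real.exp_log (by positivity)]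
    rw [Real.exp_neg]
    push_cast
    have : cexp (u : ℂ) ≠ 0 := Complex.exp_ne_zero _
    field_simp
    ring
  unfold besselMellinKernel
  rw [h2, h3, h4, Real.log_div ht.ne' two_ne_zero]
  push_cast
  rw [show -(cexp u + cexp (-u) / 4 * (t : ℂ) ^ 2)
      - μ * ((u : ℂ) - ((Real.log t : ℝ) - (Real.log 2 : ℝ)))
      = (-μ * (Real.log 2 : ℝ)) + μ * (Real.log t : ℝ)
        + (-(cexp (-u) / 4 * (t : ℂ) ^ 2)) + (-(cexp u) - μ * u) by ring]
  simp only [Complex.exp_add]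
  ring

theorem integral_besselMellinKernel_left {μ w : ℂ} (h : 0 < (w + μ).re) (u : ℝ) :
    IntegrableOn (fun t => besselMellinKernel μ w t u) (Ioi 0) ∧
    ∫ t in Ioi 0, besselMellinKernel μ w t u
      = (2 : ℂ) ^ (w + μ - 1) * Gamma ((w + μ) / 2)
        * cexp (-(((1 : ℝ) : ℂ) * cexp u) - -((w - μ) / 2) * u) := by
  have hb : 0 < Real.exp (-u) / 4 := by positivity
  obtain ⟨h1, h2⟩ := hasMellin_exp_neg_mul_sq hb h
  simp only [MellinConvergent, mellin, smul_eq_mul] at h1 h2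
  refine ⟨h1.mul_const _, ?_⟩
  unfold besselMellinKernel
  rw [integral_mul_const, h2]
  have e : (1 / ((Real.exp (-u) / 4 : ℝ) : ℂ)) ^ ((w + μ) / 2)
      = (2 : ℂ) ^ (w + μ) * cexp ((w + μ) / 2 * u) := by
    have : (1 / ((Real.exp (-u) / 4 : ℝ) : ℂ)) = ((4 * Real.exp u : ℝ) : ℂ) := by
      rw [Real.exp_neg]; push_cast; field_simp
    rw [this, cpow_def_of_ne_zero (by exact_mod_cast (by positivity : 4 * Real.exp u ≠ 0)),
      ← ofReal_log (by positivity), Real.log_mul (by norm_num) (Real.exp_pos _).ne', Real.log_exp,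
      show (4 : ℝ) = 2 ^ 2 by norm_num, Real.log_pow, cpow_def_of_ne_zero two_ne_zero,
      show (2 : ℂ) = ((2 : ℝ) : ℂ) by simp, ← ofReal_log zero_le_two, ← Complex.exp_add]
    push_cast
    congr 1; ring
  have e2 : (2 : ℂ) ^ (w + μ) = 2 * (2 : ℂ) ^ (w + μ - 1) := by
    rw [cpow_sub _ _ two_ne_zero, cpow_one]; field_simp
  rw [e, e2, show -(((1 : ℝ) : ℂ) * cexp u) - -((w - μ) / 2) * u
    = (w + μ) / 2 * u + (-(cexp u) - μ * u) by push_cast; ring, Complex.exp_add]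
  ring

/-- Because the modulus is again a kernel, with parameters Re μ and Re w, its integral has the same
closed form; this verifies Fubini's condition. -/
theorem norm_besselMellinKernel (μ w : ℂ) {t : ℝ} (ht : 0 < t) (u : ℝ) :
    ((‖besselMellinKernel μ w t u‖ : ℝ) : ℂ) = besselMellinKernel μ.re w.re t u := by
  unfold besselMellinKernel
  rw [norm_mul, norm_mul, norm_cpow_eq_rpow_re_of_pos ht, Complex.norm_exp, Complex.norm_exp]
  push_cast [ofReal_cpow ht.le]
  have e1 : (-(cexp u) - μ * u).re = -Real.exp u - μ.re * u := by simp [exp_ofReal_re]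
  have e2 : (-(cexp (-(u : ℂ)) / 4 * (t : ℂ) ^ 2)).re = -(Real.exp (-u) / 4 * t ^ 2) := by
    rw [← ofReal_neg u, ← ofReal_exp, ← ofReal_pow]; norm_cast
  rw [e1, e2]
  simp

theorem integrable_besselMellinKernel {μ w : ℂ} (h : |μ.re| < w.re) :
    Integrable (Function.uncurry (besselMellinKernel μ w))
      ((volume.restrict (Ioi 0)).prod volume) := by
  have hh := abs_lt.1 h
  have hm : AEStronglyMeasurable (Function.uncurry (besselMellinKernel μ w))
      ((volume.restrict (Ioi (0 : ℝ))).prod volume) := by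
    refine AEMeasurable.aestronglyMeasurable (Measurable.aemeasurable ?_)
    unfold Function.uncurry besselMellinKernel
    fun_prop
  rw [integrable_prod_iff' hm]
  refine ⟨.of_forall fun u => (integral_besselMellinKernel_left (by simp; linarith) u).1, ?_⟩
  have e : ∀ u, ∫ t in Ioi 0, ‖besselMellinKernel μ w t u‖
      = ‖(2 : ℂ) ^ ((w.re : ℂ) + μ.re - 1) * Gamma (((w.re : ℂ) + μ.re) / 2)
        * cexp (-(((1 : ℝ) : ℂ) * cexp u) - -(((w.re : ℂ) - μ.re) / 2) * u)‖ := by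
    intro u
    rw [← (integral_besselMellinKernel_left (by simp; linarith) u).2,
      ← setIntegral_congr_fun measurableSet_Ioi
        (fun t ht => norm_besselMellinKernel μ w (mem_Ioi.1 ht) u), integral_complex_ofReal, norm_real,
      Real.norm_of_nonneg (integral_nonneg fun t => norm_nonneg _)]
  simp only [Function.uncurry_apply_pair, e]
  refine ((integrable_exp_neg_mul_exp one_pos ?_).const_mul _).norm
  have e3 : (-(((w.re : ℂ) - μ.re) / 2)).re = -((w.re - μ.re) / 2) := by
    rw [← ofReal_sub]; norm_cast
  rw [e3]; linarith

theorem besselK_mellin {μ w : ℂ} (h : |μ.re| < w.re) :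
    IntegrableOn (fun t : ℝ => (t : ℂ) ^ (w - 1) * besselK μ t) (Ioi 0) ∧
    ∫ t : ℝ in Ioi 0, (t : ℂ) ^ (w - 1) * besselK μ t
      = (2 : ℂ) ^ (w - 2) * Gamma ((w - μ) / 2) * Gamma ((w + μ) / 2) := by
  have hh := abs_lt.1 h
  have hi := integrable_besselMellinKernel h
  have e : ∀ t ∈ Ioi (0 : ℝ), (t : ℂ) ^ (w - 1) * besselK μ t
      = (2 : ℂ) ^ (-μ - 1) * ∫ u : ℝ, besselMellinKernel μ w t u :=
    fun t ht => besselK_eq_integral_besselMellinKernel ht μ w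
  constructor
  · rw [integrableOn_congr_fun e measurableSet_Ioi]
    exact hi.integral_prod_left.const_mul _
  · rw [setIntegral_congr_fun measurableSet_Ioi e, integral_const_mul, integral_integral_swap hi]
    simp only [(integral_besselMellinKernel_left (show 0 < (w + μ).re by simp; linarith) _).2]
    rw [integral_const_mul, integral_exp_neg_mul_exp one_pos (by simp; linarith)]
    have e2 : (2 : ℂ) ^ (w - 2) = (2 : ℂ) ^ (-μ - 1) * (2 : ℂ) ^ (w + μ - 1) := by
      rw [← cpow_add _ _ two_ne_zero]; ring_nf
    rw [e2, ofReal_one, one_cpow, neg_neg]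
    ring

theorem norm_besselK_le (μ : ℂ) {t : ℝ} (ht : 0 < t) :
    0 ≤ (besselK μ.re t).re ∧ besselK μ.re t = (besselK μ.re t).re ∧
      ‖besselK μ t‖ ≤ (besselK μ.re t).re := by
  have e : ∀ u : ℝ, ((‖cexp (-(t * cosh u) - μ * u)‖ : ℝ) : ℂ)
      = cexp (-(t * cosh u) - μ.re * u) := fun u => by
    rw [Complex.norm_exp, ← ofReal_cosh]
    push_cast
    congr 1
    simp
  have h1 : besselK μ.re t
      = ((1 / 2 * ∫ u : ℝ, ‖cexp (-(t * cosh u) - μ * u)‖ : ℝ) : ℂ) := by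
    rw [besselK_eq_integral ht]
    simp_rw [← e]
    rw [integral_complex_ofReal]
    push_cast
    rfl
  have h2 : (besselK μ.re t).re = 1 / 2 * ∫ u : ℝ, ‖cexp (-(t * cosh u) - μ * u)‖ := by
    rw [h1, ofReal_re]
  refine ⟨?_, ?_, ?_⟩
  · rw [h2]
    exact mul_nonneg (by norm_num) (integral_nonneg fun _ => norm_nonneg _)
  · rw [h2, h1]
  · rw [h2, besselK_eq_integral ht, norm_mul]
    gcongr
    · simp
    · exact norm_integral_le_integral_norm _

/-- Since |K_μ| ≤ K_{Re μ}, the absolute integral is at most the Mellin transform with real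
parameters. This is the majorant for the later interchange with the contour integral. -/
theorem integral_norm_besselK_le {μ w : ℂ} (h : |μ.re| < w.re) :
    ∫ t : ℝ in Ioi 0, ‖(t : ℂ) ^ (w - 1) * besselK μ t‖
      ≤ ‖(2 : ℂ) ^ ((w.re : ℂ) - 2) * Gamma (((w.re : ℂ) - μ.re) / 2)
          * Gamma (((w.re : ℂ) + μ.re) / 2)‖ := by
  obtain ⟨hi, hv⟩ := besselK_mellin (μ := μ.re) (w := w.re) (by simpa using h)
  rw [← hv]
  have e : ∀ t ∈ Ioi (0 : ℝ), (t : ℂ) ^ ((w.re : ℂ) - 1) * besselK μ.re t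
      = ((t ^ (w.re - 1) * (besselK μ.re t).re : ℝ) : ℂ) := fun t ht => by
    rw [mem_Ioi] at ht
    conv_lhs => rw [(norm_besselK_le μ ht).2.1]
    push_cast [ofReal_cpow ht.le]
    rfl
  have hi' := (integrableOn_congr_fun e measurableSet_Ioi).1 hi
  have hnn : ∀ t ∈ Ioi (0 : ℝ), 0 ≤ t ^ (w.re - 1) * (besselK μ.re t).re := fun t ht =>
    mul_nonneg (Real.rpow_nonneg (mem_Ioi.1 ht).le _) (norm_besselK_le μ ht).1
  rw [setIntegral_congr_fun measurableSet_Ioi e, integral_complex_ofReal, norm_real,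
    Real.norm_of_nonneg (setIntegral_nonneg measurableSet_Ioi hnn)]
  refine setIntegral_mono_on (besselK_mellin h).1.norm hi'.re measurableSet_Ioi fun t ht => ?_
  rw [norm_mul, norm_cpow_eq_rpow_re_of_pos ht]
  have := (norm_besselK_le μ ht).2.2
  have ht' : 0 ≤ t := (mem_Ioi.1 ht).le
  simp only [sub_re, one_re]
  gcongr

/-! ### Bounds for the Gamma function in a right half-plane -/

theorem norm_sin_le_exp (z : ℂ) : ‖sin z‖ ≤ Real.exp |z.im| := by
  rw [Complex.sin, norm_div, norm_mul, norm_I, mul_one]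
  have h1 : ‖cexp (-z * I)‖ ≤ Real.exp |z.im| := by
    rw [Complex.norm_exp]; simpa using le_abs_self z.im
  have h2 : ‖cexp (z * I)‖ ≤ Real.exp |z.im| := by
    rw [Complex.norm_exp]; simpa using neg_le_abs z.im
  have := norm_sub_le (cexp (-z * I)) (cexp (z * I))
  rw [show ‖(2 : ℂ)‖ = 2 by simp]
  linarith

theorem exp_le_norm_sin {z : ℂ} (hz : 1 ≤ |z.im|) : Real.exp |z.im| ≤ 4 * ‖sin z‖ := by
  have e1 : ‖cexp (-z * I)‖ = Real.exp z.im := by rw [Complex.norm_exp]; simp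
  have e2 : ‖cexp (z * I)‖ = Real.exp (-z.im) := by rw [Complex.norm_exp]; simp
  have h1 := abs_norm_sub_norm_le (cexp (-z * I)) (cexp (z * I))
  rw [e1, e2] at h1
  have hs : ‖sin z‖ = ‖cexp (-z * I) - cexp (z * I)‖ / 2 := by
    rw [Complex.sin, norm_div, norm_mul, norm_I, mul_one]; simp
  have hk : ∀ v : ℝ, 1 ≤ v → 2 * Real.exp (-v) ≤ Real.exp v := fun v hv => by
    have a1 := Real.add_one_le_exp v
    have a2 : Real.exp (-v) ≤ 1 := Real.exp_le_one_iff.2 (by linarith)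
    linarith
  rcases abs_cases z.im with ⟨h, _⟩ | ⟨h, _⟩
  · rw [h] at hz ⊢
    have := le_abs_self (Real.exp z.im - Real.exp (-z.im))
    linarith [hk _ hz]
  · rw [h] at hz ⊢
    have := neg_le_abs (Real.exp z.im - Real.exp (-z.im))
    have := hk _ hz
    rw [neg_neg] at this
    linarith

/-- On Re s = 1/2, 1 - s is the conjugate of s, so the reflection formula gives |Γ(s)|² = π/|sin
πs|. -/
theorem sqrt_pi_le_norm_Gamma (y : ℝ) :
    √Real.pi ≤ Real.exp (Real.pi * |y| / 2) * ‖Gamma (((1 / 2 : ℝ) : ℂ) + y * I)‖ := by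
  have h := Complex.Gamma_mul_Gamma_one_sub (((1 / 2 : ℝ) : ℂ) + y * I)
  have hc : 1 - (((1 / 2 : ℝ) : ℂ) + y * I) = (starRingEnd ℂ) (((1 / 2 : ℝ) : ℂ) + y * I) := by
    simp only [map_add, map_mul, conj_ofReal, conj_I]; push_cast; ring
  rw [hc, Complex.Gamma_conj] at h
  have h2 := congrArg norm h
  rw [norm_mul, RCLike.norm_conj, norm_div, norm_real, Real.norm_of_nonneg Real.pi_pos.le] at h2
  have h3 := norm_sin_le_exp ((Real.pi : ℂ) * (((1 / 2 : ℝ) : ℂ) + y * I))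
  have him : ((Real.pi : ℂ) * (((1 / 2 : ℝ) : ℂ) + y * I)).im = Real.pi * y := by simp
  rw [him, abs_mul, abs_of_pos Real.pi_pos] at h3
  have hs : 0 < ‖sin ((Real.pi : ℂ) * (((1 / 2 : ℝ) : ℂ) + y * I))‖ := by
    by_contra hn
    rw [le_antisymm (not_lt.1 hn) (norm_nonneg _), div_zero, mul_self_eq_zero, norm_eq_zero] at h2
    exact Gamma_ne_zero_of_re_pos (by simp) h2
  rw [eq_div_iff hs.ne'] at h2
  refine Real.sqrt_le_iff.2 ⟨by positivity, ?_⟩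
  rw [mul_pow, ← Real.exp_nat_mul, pow_two ‖_‖,
    show ((2 : ℕ) : ℝ) * (Real.pi * |y| / 2) = Real.pi * |y| by push_cast; ring]
  calc Real.pi = _ := h2.symm
    _ ≤ _ := by rw [mul_comm]; gcongr

/-- The ratio |Γ(σ+iy)|/Γ(σ) is nondecreasing in σ: in Euler's limit formula it is a product of
factors (σ+j)/|σ+j+iy|, each of them nondecreasing. It suffices to know it at σ = 1/2. -/
theorem Gamma_le_exp_mul_norm_Gamma {σ : ℝ} (hσ : 1 / 2 ≤ σ) (y : ℝ) :
    Real.Gamma σ ≤ Real.exp (Real.pi * |y| / 2) * ‖Gamma ((σ : ℂ) + y * I)‖ := by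
  have hseq : ∀ n : ℕ, Real.GammaSeq σ n * ‖GammaSeq (((1 / 2 : ℝ) : ℂ) + y * I) n‖
      ≤ Real.GammaSeq (1 / 2) n * ‖GammaSeq ((σ : ℂ) + y * I) n‖ := by
    intro n
    rcases Nat.eq_zero_or_pos n with rfl | hn
    · have h0 : σ ≠ 0 := by linarith
      simp [Real.GammaSeq, GammaSeq, h0]
    have hn' : (0 : ℝ) < n := by exact_mod_cast hn
    have hnorm : ∀ τ : ℝ, ‖GammaSeq ((τ : ℂ) + y * I) n‖
        = (n : ℝ) ^ τ * n.factorial / ∏ j ∈ Finset.range (n + 1), ‖(τ : ℂ) + y * I + j‖ := by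
      intro τ
      rw [GammaSeq, norm_div, norm_mul, norm_prod, Complex.norm_natCast,
        show (n : ℂ) = ((n : ℝ) : ℂ) by simp, norm_cpow_eq_rpow_re_of_pos hn']
      simp
    have hpos : ∀ τ : ℝ, 1 / 2 ≤ τ → 0 < ∏ j ∈ Finset.range (n + 1), ‖(τ : ℂ) + y * I + j‖ := by
      intro τ hτ
      refine Finset.prod_pos fun j _ => norm_pos_iff.2 fun h => ?_
      have := congrArg re h
      simp at this
      have hj : (0 : ℝ) ≤ j := Nat.cast_nonneg j
      linarith
    have hpos' : ∀ τ : ℝ, 1 / 2 ≤ τ → 0 < ∏ j ∈ Finset.range (n + 1), (τ + j) := by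
      intro τ hτ
      exact Finset.prod_pos fun j _ => by positivity
    rw [hnorm, hnorm, Real.GammaSeq, Real.GammaSeq, div_mul_div_comm, div_mul_div_comm,
      div_le_div_iff₀ (mul_pos (hpos' _ hσ) (hpos _ le_rfl))
        (mul_pos (hpos' _ le_rfl) (hpos _ hσ)),
      ← Finset.prod_mul_distrib, ← Finset.prod_mul_distrib]
    rw [mul_comm ((n : ℝ) ^ σ * _) ((n : ℝ) ^ (1 / 2 : ℝ) * _)]
    refine mul_le_mul_of_nonneg_left ?_ (by positivity)
    refine Finset.prod_le_prod (fun j _ => by positivity) fun j _ => ?_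
    have hj : (0 : ℝ) ≤ j := Nat.cast_nonneg j
    have hsq : ∀ τ : ℝ, ‖(τ : ℂ) + y * I + j‖ ^ 2 = (τ + j) ^ 2 + y ^ 2 := by
      intro τ
      rw [← normSq_eq_norm_sq, normSq_apply]
      simp; ring
    refine (sq_le_sq₀ (by positivity) (by positivity)).1 ?_
    rw [mul_pow, mul_pow, hsq, hsq]
    have : (1 / 2 + (j : ℝ)) ^ 2 ≤ (σ + j) ^ 2 := by gcongr
    nlinarith [mul_le_mul_of_nonneg_right this (sq_nonneg y)]
  have lim := le_of_tendsto_of_tendsto'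
    ((Real.GammaSeq_tendsto_Gamma σ).mul (GammaSeq_tendsto_Gamma (((1 / 2 : ℝ) : ℂ) + y * I)).norm)
    ((Real.GammaSeq_tendsto_Gamma (1 / 2)).mul (GammaSeq_tendsto_Gamma ((σ : ℂ) + y * I)).norm) hseq
  rw [Real.Gamma_one_half_eq] at lim
  have h := sqrt_pi_le_norm_Gamma y
  have hpi : 0 < √Real.pi := Real.sqrt_pos.2 Real.pi_pos
  have hG : 0 ≤ Real.Gamma σ := (Real.Gamma_pos_of_pos (by linarith)).le
  have hE := Real.exp_pos (Real.pi * |y| / 2)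
  refine le_of_mul_le_mul_left ?_ hpi
  calc √Real.pi * Real.Gamma σ
      ≤ (Real.exp (Real.pi * |y| / 2) * ‖Gamma (((1 / 2 : ℝ) : ℂ) + y * I)‖) * Real.Gamma σ := by
        gcongr
    _ = Real.exp (Real.pi * |y| / 2) * (Real.Gamma σ * ‖Gamma (((1 / 2 : ℝ) : ℂ) + y * I)‖) := by
        ring
    _ ≤ Real.exp (Real.pi * |y| / 2) * (√Real.pi * ‖Gamma ((σ : ℂ) + y * I)‖) := by gcongr
    _ = _ := by ring

/-- Keep only the part x > A of Euler's integral. As A is arbitrary, 1/Γ decays faster than any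
exponential. -/
theorem rpow_mul_exp_neg_le_Gamma {A u : ℝ} (hA : 0 < A) (hu : 1 ≤ u) :
    A ^ (u - 1) * Real.exp (-A) ≤ Real.Gamma u := by
  rw [Real.Gamma_eq_integral (by linarith)]
  have hi := Real.GammaIntegral_convergent (show 0 < u by linarith)
  calc A ^ (u - 1) * Real.exp (-A) = ∫ x in Ioi A, Real.exp (-x) * A ^ (u - 1) := by
        rw [integral_mul_const, integral_exp_neg_Ioi]; ring
    _ ≤ ∫ x in Ioi A, Real.exp (-x) * x ^ (u - 1) := by
        refine setIntegral_mono_on ?_ (hi.mono_set (Ioi_subset_Ioi hA.le)) measurableSet_Ioi ?_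
        · exact (integrableOn_exp_neg_Ioi A).mul_const _
        · intro x hx
          have := (mem_Ioi.1 hx).le
          have : 0 ≤ u - 1 := by linarith
          gcongr
    _ ≤ ∫ x in Ioi 0, Real.exp (-x) * x ^ (u - 1) := by
        refine setIntegral_mono_set hi ?_ (Ioi_subset_Ioi hA.le).eventuallyLE
        refine (ae_restrict_iff' measurableSet_Ioi).2 (.of_forall fun x hx => ?_)
        have : (0 : ℝ) ≤ x := (mem_Ioi.1 hx).le
        simp only [Pi.zero_apply]
        positivity

/-- A quotient of two values of the Gamma function grows at most polynomially. -/
theorem exists_norm_Gamma_div_Gamma_le {C : ℝ} {α : ℂ} (hα : 0 < C + α.re) (β : ℂ) :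
    ∃ (M : ℝ) (N : ℕ), 0 ≤ M ∧ ∀ s : ℂ, C ≤ s.re →
      ‖Gamma (s + α) / Gamma (s + β)‖ ≤ M * (1 + ‖s‖) ^ N := by
  -- If Re α < Re β, the quotient is a Beta integral over Γ(β-α), and its absolute integrand is
  -- largest at Re s = C. Otherwise 1/Γ(s+β) = (s+β)/Γ(s+β+1) raises β at the cost of one linear
  -- factor.
  obtain ⟨k, hk⟩ := exists_nat_gt (α - β).re
  induction k generalizing β with
  | zero =>
    have hγ : 0 < (β - α).re := by
      rw [← neg_sub, neg_re]; simpa using hk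
    have hci := betaIntegral_convergent (u := ((C + α.re : ℝ) : ℂ)) (v := β - α) (by simpa using hα) hγ
    refine ⟨(∫ x in (0 : ℝ)..1, ‖(x : ℂ) ^ (((C + α.re : ℝ) : ℂ) - 1) * (1 - (x : ℂ)) ^ (β - α - 1)‖)
      / ‖Gamma (β - α)‖, 0, ?_, fun s hs => ?_⟩
    · exact div_nonneg (intervalIntegral.integral_nonneg zero_le_one fun x _ => norm_nonneg _)
        (norm_nonneg _)
    have hsα : 0 < (s + α).re := by simp; linarith
    have hG := Gamma_ne_zero_of_re_pos hγ
    have hsβ : Gamma (s + β) ≠ 0 := Gamma_ne_zero_of_re_pos (by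
      rw [show s + β = (s + α) + (β - α) by ring, add_re]; linarith)
    have hB := Gamma_mul_Gamma_eq_betaIntegral hsα hγ
    rw [show s + α + (β - α) = s + β by ring] at hB
    have e : Gamma (s + α) / Gamma (s + β) = betaIntegral (s + α) (β - α) / Gamma (β - α) := by
      rw [div_eq_div_iff hsβ hG, hB]; ring
    rw [e, norm_div, pow_zero, mul_one]
    gcongr
    rw [betaIntegral]
    refine (intervalIntegral.norm_integral_le_integral_norm zero_le_one).trans ?_
    refine intervalIntegral.integral_mono_on_of_le_Ioo zero_le_one
      (betaIntegral_convergent hsα hγ).norm hci.norm fun x hx => ?_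
    rw [norm_mul, norm_mul, norm_cpow_eq_rpow_re_of_pos hx.1, norm_cpow_eq_rpow_re_of_pos hx.1]
    refine mul_le_mul_of_nonneg_right ?_ (norm_nonneg _)
    refine Real.rpow_le_rpow_of_exponent_ge hx.1 hx.2.le ?_
    simp; linarith
  | succ k ih =>
    obtain ⟨M, N, hM, h⟩ := ih (β + 1) (by
      push_cast at hk
      simp only [sub_re, add_re, one_re] at hk ⊢; linarith)
    refine ⟨M * (1 + ‖β‖), N + 1, by positivity, fun s hs => ?_⟩
    have h1 := Complex.one_div_Gamma_eq_self_mul_one_div_Gamma_add_one (s + β)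
    rw [div_eq_mul_one_div]
    rw [one_div, h1, add_assoc s β 1, ← mul_assoc, mul_comm (Gamma (s + α)), mul_assoc,
      ← div_eq_mul_inv, norm_mul]
    have h2 : ‖s + β‖ ≤ (1 + ‖β‖) * (1 + ‖s‖) := by
      have := norm_add_le s β
      nlinarith [mul_nonneg (norm_nonneg s) (norm_nonneg β)]
    calc ‖s + β‖ * ‖Gamma (s + α) / Gamma (s + (β + 1))‖
        ≤ ((1 + ‖β‖) * (1 + ‖s‖)) * (M * (1 + ‖s‖) ^ N) := by
          gcongr
          exact h s hs
      _ = _ := by ring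

/-- The complex shift β is traded for the real shift c at polynomial cost, after which the lower
bound for Γ on Re ≥ 1/2 applies. -/
theorem exists_norm_inv_Gamma_le {C c : ℝ} (hc : 1 / 2 ≤ C + c) (β : ℂ) :
    ∃ (M : ℝ) (N : ℕ), 0 ≤ M ∧ ∀ s : ℂ, C ≤ s.re →
      ‖(Gamma (s + β))⁻¹‖ ≤ M * (1 + ‖s‖) ^ N *
        (Real.exp (Real.pi * |s.im| / 2) / Real.Gamma (s.re + c)) := by
  obtain ⟨M, N, hM, h⟩ := exists_norm_Gamma_div_Gamma_le (C := C) (α := c)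
    (by simp only [ofReal_re]; linarith) β
  refine ⟨M, N, hM, fun s hs => ?_⟩
  have h1 := Gamma_le_exp_mul_norm_Gamma (show 1 / 2 ≤ s.re + c by linarith) s.im
  have e : (((s.re + c : ℝ) : ℂ) + s.im * I) = s + c := by
    conv_rhs => rw [← re_add_im s]
    push_cast; ring
  rw [e] at h1
  have hG : 0 < Real.Gamma (s.re + c) := Real.Gamma_pos_of_pos (by linarith)
  have hG' : Gamma (s + c) ≠ 0 := Gamma_ne_zero_of_re_pos (by simp; linarith)
  have e2 : (Gamma (s + β))⁻¹ = Gamma (s + c) / Gamma (s + β) * (Gamma (s + c))⁻¹ := by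
    field_simp
  rw [e2, norm_mul, norm_inv]
  have hn : 0 < ‖Gamma (s + c)‖ := norm_pos_iff.2 hG'
  have h3 : ‖Gamma (s + c)‖⁻¹ ≤ Real.exp (Real.pi * |s.im| / 2) / Real.Gamma (s.re + c) := by
    rw [inv_eq_one_div, div_le_div_iff₀ hn hG, one_mul]
    exact h1
  gcongr
  exact h s hs

/-! ### Bounds for the integrand of the Meijer G-function -/

theorem Gamma_sub_eq {β s : ℂ} (h : β.im ≠ s.im) :
    Gamma (β - s) = Real.pi / sin (Real.pi * (β - s)) * (Gamma (1 - β + s))⁻¹ := by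
  have hr := Complex.Gamma_mul_Gamma_one_sub (β - s)
  rw [show 1 - (β - s) = 1 - β + s by ring] at hr
  have hG : Gamma (1 - β + s) ≠ 0 := Gamma_ne_zero fun k hk => h (by
    have := congrArg im hk
    simp at this
    linarith)
  rw [← hr]
  field_simp

theorem norm_pi_div_sin_le {β s : ℂ} (h : |β.im| + 1 ≤ |s.im|) :
    ‖(Real.pi : ℂ) / sin (Real.pi * (β - s))‖
      ≤ 4 * Real.pi * Real.exp (Real.pi * |β.im|) * Real.exp (-(Real.pi * |s.im|)) := by
  have him : ((Real.pi : ℂ) * (β - s)).im = Real.pi * (β.im - s.im) := by simp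
  have hpi := Real.pi_pos
  have h1 : |s.im| - |β.im| ≤ |β.im - s.im| := by
    rw [abs_sub_comm]; exact abs_sub_abs_le_abs_sub _ _
  have h2 : 1 ≤ |((Real.pi : ℂ) * (β - s)).im| := by
    rw [him, abs_mul, abs_of_pos hpi]
    nlinarith [Real.pi_gt_three]
  have h3 := exp_le_norm_sin h2
  rw [him, abs_mul, abs_of_pos hpi] at h3
  have h4 : Real.exp (Real.pi * (|s.im| - |β.im|)) ≤ 4 * ‖sin ((Real.pi : ℂ) * (β - s))‖ :=
    (Real.exp_le_exp.2 (by gcongr)).trans h3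
  have hpos : 0 < ‖sin ((Real.pi : ℂ) * (β - s))‖ := by
    have := Real.exp_pos (Real.pi * (|s.im| - |β.im|)); linarith
  rw [norm_div, norm_real, Real.norm_of_nonneg hpi.le, div_le_iff₀ hpos]
  rw [mul_assoc, mul_assoc, mul_assoc, mul_left_comm]
  refine le_mul_of_one_le_right hpi.le ?_
  have e : Real.exp (Real.pi * |β.im|) * Real.exp (-(Real.pi * |s.im|))
      * Real.exp (Real.pi * (|s.im| - |β.im|)) = 1 := by
    rw [← Real.exp_add, ← Real.exp_add, ← Real.exp_zero]; ring_nf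
  calc (1 : ℝ) = _ := e.symm
    _ ≤ Real.exp (Real.pi * |β.im|) * Real.exp (-(Real.pi * |s.im|))
        * (4 * ‖sin ((Real.pi : ℂ) * (β - s))‖) := by gcongr
    _ = _ := by ring

theorem exists_norm_prod_Gamma_sub_le (b : List ℂ) :
    ∃ M : ℝ, 0 ≤ M ∧ ∀ s : ℂ, (∀ β ∈ b, |β.im| + 1 ≤ |s.im|) →
      ‖(b.map fun β => Gamma (β - s)).prod‖ ≤ M * Real.exp (-(Real.pi * b.length * |s.im|)) *
        ‖((b.map fun β => Gamma (1 - β + s)).prod)⁻¹‖ := by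
  induction b with
  | nil => exact ⟨1, zero_le_one, fun s _ => by simp⟩
  | cons β b ih =>
    obtain ⟨M, hM, h⟩ := ih
    refine ⟨4 * Real.pi * Real.exp (Real.pi * |β.im|) * M, by positivity, fun s hs => ?_⟩
    have hβ := hs β (by simp)
    have h1 := h s fun β' hβ' => hs β' (by simp [hβ'])
    have hne : β.im ≠ s.im := fun he => by rw [he] at hβ; linarith
    simp only [List.map_cons, List.prod_cons, List.length_cons]
    rw [norm_mul, Gamma_sub_eq hne, norm_mul, mul_inv, norm_mul]
    have e : Real.exp (-(Real.pi * ((b.length + 1 : ℕ) : ℝ) * |s.im|))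
        = Real.exp (-(Real.pi * |s.im|)) * Real.exp (-(Real.pi * b.length * |s.im|)) := by
      rw [← Real.exp_add]; push_cast; ring_nf
    rw [e]
    calc _ ≤ (4 * Real.pi * Real.exp (Real.pi * |β.im|) * Real.exp (-(Real.pi * |s.im|)))
            * ‖(Gamma (1 - β + s))⁻¹‖ * (M * Real.exp (-(Real.pi * b.length * |s.im|)) *
              ‖((b.map fun β => Gamma (1 - β + s)).prod)⁻¹‖) := by
          gcongr
          exact norm_pi_div_sin_le hβ
      _ = _ := by ring

/-- Each numerator Gamma is paired with a denominator Gamma and costs a polynomial factor; each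
unpaired reciprocal Gamma supplies one factor of the decaying power. -/
theorem exists_norm_prod_Gamma_div_prod_Gamma_le {C c : ℝ} (hc : 1 / 2 ≤ C + c) (b : List ℂ) :
    ∀ a : List ℂ, a.length ≤ b.length → (∀ α ∈ a, α.re - 1 < C) →
    ∃ (M : ℝ) (N : ℕ), 0 ≤ M ∧ ∀ s : ℂ, C ≤ s.re →
      ‖(a.map fun α => Gamma (1 - α + s)).prod / (b.map fun β => Gamma (1 - β + s)).prod‖
        ≤ M * (1 + ‖s‖) ^ N *
        (Real.exp (Real.pi * |s.im| / 2) / Real.Gamma (s.re + c)) ^ (b.length - a.length) := by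
  have hE : ∀ s : ℂ, C ≤ s.re → 0 ≤ Real.exp (Real.pi * |s.im| / 2) / Real.Gamma (s.re + c) :=
    fun s hs => div_nonneg (Real.exp_pos _).le (Real.Gamma_pos_of_pos (by linarith)).le
  induction b with
  | nil =>
    intro a ha _
    have : a = [] := List.eq_nil_of_length_eq_zero (Nat.le_zero.1 ha)
    subst this
    exact ⟨1, 0, zero_le_one, fun s _ => by simp⟩
  | cons β b ih =>
    intro a ha hα
    cases a with
    | nil =>
      obtain ⟨M, N, hM, h⟩ := ih [] (by simp) (by simp)
      obtain ⟨M', N', hM', h'⟩ := exists_norm_inv_Gamma_le hc (1 - β)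
      refine ⟨M' * M, N' + N, by positivity, fun s hs => ?_⟩
      have h1 := h s hs
      have h2 := h' s hs
      rw [add_comm s] at h2
      simp only [List.map_nil, List.prod_nil, List.length_nil, Nat.sub_zero, List.map_cons,
        List.prod_cons, List.length_cons, one_div] at h1 ⊢
      rw [mul_inv, norm_mul]
      have hE' := hE s hs
      calc _ ≤ (M' * (1 + ‖s‖) ^ N' *
            (Real.exp (Real.pi * |s.im| / 2) / Real.Gamma (s.re + c))) * _ :=
            mul_le_mul h2 h1 (norm_nonneg _) (by positivity)
        _ = _ := by ring
    | cons α a =>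
      obtain ⟨M, N, hM, h⟩ := ih a (by simpa using ha) fun α' hα' => hα α' (by simp [hα'])
      obtain ⟨M', N', hM', h'⟩ := exists_norm_Gamma_div_Gamma_le (C := C) (α := 1 - α)
        (by have := hα α (by simp); simp; linarith) (1 - β)
      refine ⟨M' * M, N' + N, by positivity, fun s hs => ?_⟩
      have h1 := h s hs
      have h2 := h' s hs
      rw [add_comm s, add_comm s] at h2
      simp only [List.map_cons, List.prod_cons, List.length_cons, Nat.add_sub_add_right]
      rw [mul_div_mul_comm, norm_mul]
      have hE' := hE s hs
      calc _ ≤ (M' * (1 + ‖s‖) ^ N') * _ :=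
            mul_le_mul h2 h1 (norm_nonneg _) (by positivity)
        _ = _ := by ring

theorem exists_one_add_pow_le_exp (N : ℕ) {η : ℝ} (hη : 0 < η) :
    ∃ M : ℝ, 0 ≤ M ∧ ∀ x : ℝ, 0 ≤ x → (1 + x) ^ N ≤ M * Real.exp (η * x) := by
  refine ⟨N.factorial / η ^ N * Real.exp η, by positivity, fun x hx => ?_⟩
  have h := Real.pow_div_factorial_le_exp (x := η * (1 + x)) (by positivity) N
  rw [div_le_iff₀ (by positivity), mul_pow] at h
  have e : Real.exp (η * (1 + x)) = Real.exp η * Real.exp (η * x) := by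
    rw [← Real.exp_add]; ring_nf
  rw [e] at h
  rw [div_mul_eq_mul_div, div_mul_eq_mul_div, le_div_iff₀ (by positivity)]
  linarith

theorem lt_of_meijerHeight_le {m : ℕ} {b : List ℂ} {y : ℝ} (h : meijerHeight m b ≤ |y|) :
    ∀ β ∈ b.take m, |β.im| + 1 ≤ |y| := by
  intro β hβ
  have := List.single_le_sum (l := (b.take m).map fun β => |β.im|)
    (fun x hx => by obtain ⟨_, _, rfl⟩ := List.mem_map.1 hx; exact abs_nonneg _) |β.im|
    (List.mem_map.2 ⟨β, hβ, rfl⟩)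
  unfold meijerHeight at h
  linarith

theorem meijerHeight_pos (m : ℕ) (b : List ℂ) : 0 < meijerHeight m b := by
  have : 0 ≤ ((b.take m).map fun β => |β.im|).sum := List.sum_nonneg fun x hx => by
    obtain ⟨_, _, rfl⟩ := List.mem_map.1 hx; exact abs_nonneg _
  unfold meijerHeight
  linarith

theorem meijerIntegrand_length (m : ℕ) (a b : List ℂ) (z s : ℂ) :
    meijerIntegrand m a.length a b z s = ((b.take m).map fun β => Gamma (β - s)).prod
      * (a.map fun α => Gamma (1 - α + s)).prod
      / ((b.drop m).map fun β => Gamma (1 - β + s)).prod * z ^ s := by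
  simp [meijerIntegrand]

/-- The integrand of a Meijer G-function with `n = p < q` decays faster than any exponential in the
direction of the positive real axis, and like `exp ((|arg z| - δ π) |Im s|)` in the vertical
direction, up to an arbitrarily small loss. -/
theorem exists_norm_meijerIntegrand_le {m : ℕ} {a b : List ℂ} (hm : m ≤ b.length)
    (hab : a.length < b.length) {C : ℝ} (ha : ∀ α ∈ a, α.re - 1 < C) {z : ℂ} (hz : z ≠ 0) {κ : ℝ}
    (hκ : |arg z| - ((m : ℝ) + (a.length : ℝ) - ((a.length : ℝ) + (b.length : ℝ)) / 2) * Real.pi < κ)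
    (ρ : ℝ) :
    ∃ M : ℝ, ∀ s : ℂ, C ≤ s.re → meijerHeight m b ≤ |s.im| →
      ‖meijerIntegrand m a.length a b z s‖ ≤ M * Real.exp (κ * |s.im|) * Real.exp (-ρ * s.re) := by
  set k : ℕ := b.length - a.length with hk
  have hk0 : 0 < k := Nat.sub_pos_of_lt hab
  have hkc : (k : ℝ) = b.length - a.length := by rw [hk, Nat.cast_sub hab.le]
  obtain ⟨M₁, hM₁, h₁⟩ := exists_norm_prod_Gamma_sub_le (b.take m)
  -- The shift 1 - C gives Re s + c ≥ 1, as the lower bound for the real Gamma function requires.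
  obtain ⟨M₂, N, hM₂, h₂⟩ := exists_norm_prod_Gamma_div_prod_Gamma_le (C := C) (c := 1 - C)
    (by linarith) b a hab.le ha
  -- The slack η between κ and the true vertical rate pays for the polynomial factor.
  set η : ℝ := κ - (|arg z| -
    ((m : ℝ) + (a.length : ℝ) - ((a.length : ℝ) + (b.length : ℝ)) / 2) * Real.pi) with hη
  have hη0 : 0 < η := by rw [hη]; linarith
  obtain ⟨M₃, hM₃, h₃⟩ := exists_one_add_pow_le_exp N hη0
  -- Each of the k reciprocal Gammas is bounded by a constant times e^(-lam Re s); this lam makes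
  -- them absorb |z|^(Re s) and e^(η Re s) and leave exactly e^(-ρ Re s).
  set lam : ℝ := (Real.log ‖z‖ + ρ + η) / k with hlam
  have hlamk : lam * k = Real.log ‖z‖ + ρ + η := by rw [hlam]; field_simp
  refine ⟨M₁ * M₂ * (M₃ * Real.exp (η * (2 * |C|))) * (Real.exp (Real.exp lam + lam * C)) ^ k,
    fun s hs hy => ?_⟩
  have hG : (Real.Gamma (s.re + (1 - C)))⁻¹ ≤ Real.exp (Real.exp lam + lam * C)
      * Real.exp (-lam * s.re) := by
    have h := rpow_mul_exp_neg_le_Gamma (Real.exp_pos lam) (show 1 ≤ s.re + (1 - C) by linarith)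
    rw [← Real.exp_mul, ← Real.exp_add] at h
    refine (inv_anti₀ (Real.exp_pos _) h).trans (le_of_eq ?_)
    rw [← Real.exp_neg, ← Real.exp_add]
    congr 1; ring
  have hpoly : (1 + ‖s‖) ^ N
      ≤ M₃ * Real.exp (η * (2 * |C|)) * Real.exp (η * s.re) * Real.exp (η * |s.im|) := by
    refine (h₃ ‖s‖ (norm_nonneg s)).trans ?_
    rw [mul_assoc, mul_assoc, ← Real.exp_add, ← Real.exp_add]
    gcongr
    have h1 := norm_le_abs_re_add_abs_im s
    have h2 : |s.re| ≤ 2 * |C| + s.re := by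
      have := neg_abs_le C
      have := abs_nonneg C
      rcases abs_cases s.re with ⟨h, _⟩ | ⟨h, _⟩ <;> rw [h] <;> linarith
    nlinarith
  have hzs : ‖z ^ s‖ ≤ Real.exp (Real.log ‖z‖ * s.re) * Real.exp (|arg z| * |s.im|) := by
    rw [norm_cpow_of_ne_zero hz, Real.rpow_def_of_pos (norm_pos_iff.2 hz), div_eq_mul_inv,
      ← Real.exp_neg]
    gcongr
    rw [← abs_mul]
    exact neg_le_abs _
  have hlen : (b.take m).length = m := by simpa using hm
  have hb1 := h₁ s (lt_of_meijerHeight_le hy)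
  rw [hlen] at hb1
  have hb2 := h₂ s hs
  -- The reciprocals produced by reflecting the first m factors join the denominator, which then
  -- runs over all of b.
  have hsplit : (b.map fun β => Gamma (1 - β + s)).prod
      = ((b.take m).map fun β => Gamma (1 - β + s)).prod
        * ((b.drop m).map fun β => Gamma (1 - β + s)).prod := by
    conv_lhs => rw [← List.take_append_drop m b]
    rw [List.map_append, List.prod_append]
  have hE : 0 ≤ Real.exp (Real.pi * |s.im| / 2) / Real.Gamma (s.re + (1 - C)) :=
    div_nonneg (Real.exp_pos _).le (Real.Gamma_pos_of_pos (by linarith)).le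
  rw [meijerIntegrand_length, norm_mul, norm_div, norm_mul]
  calc ‖((b.take m).map fun β => Gamma (β - s)).prod‖
        * ‖(a.map fun α => Gamma (1 - α + s)).prod‖
        / ‖((b.drop m).map fun β => Gamma (1 - β + s)).prod‖ * ‖z ^ s‖
      ≤ (M₁ * Real.exp (-(Real.pi * m * |s.im|)) *
        ‖(((b.take m).map fun β => Gamma (1 - β + s)).prod)⁻¹‖)
        * ‖(a.map fun α => Gamma (1 - α + s)).prod‖
        / ‖((b.drop m).map fun β => Gamma (1 - β + s)).prod‖ * ‖z ^ s‖ := by gcongr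
    _ = M₁ * Real.exp (-(Real.pi * m * |s.im|))
        * ‖(a.map fun α => Gamma (1 - α + s)).prod / (b.map fun β => Gamma (1 - β + s)).prod‖
        * ‖z ^ s‖ := by
      rw [hsplit, norm_div, norm_mul, norm_inv]
      ring
    _ ≤ M₁ * Real.exp (-(Real.pi * m * |s.im|)) * (M₂ * (M₃ * Real.exp (η * (2 * |C|))
          * Real.exp (η * s.re) * Real.exp (η * |s.im|))
          * (Real.exp (Real.pi * |s.im| / 2) *
            (Real.exp (Real.exp lam + lam * C) * Real.exp (-lam * s.re))) ^ k)
        * (Real.exp (Real.log ‖z‖ * s.re) * Real.exp (|arg z| * |s.im|)) := by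
      gcongr
      refine hb2.trans ?_
      rw [div_eq_mul_inv] at hE ⊢
      gcongr
    _ = _ := by
      rw [mul_pow, mul_pow, ← Real.exp_nat_mul (Real.pi * |s.im| / 2), ← Real.exp_nat_mul (-lam * s.re)]
      have e1 : Real.exp (κ * |s.im|) = Real.exp (-(Real.pi * m * |s.im|)) * Real.exp (η * |s.im|)
          * Real.exp (k * (Real.pi * |s.im| / 2)) * Real.exp (|arg z| * |s.im|) := by
        rw [← Real.exp_add, ← Real.exp_add, ← Real.exp_add, hη, hkc]
        congr 1; ring
      have e2 : Real.exp (-ρ * s.re) = Real.exp (η * s.re) * Real.exp (k * (-lam * s.re))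
          * Real.exp (Real.log ‖z‖ * s.re) := by
        rw [← Real.exp_add, ← Real.exp_add]
        congr 1
        linear_combination s.re * hlamk
      rw [e1, e2]
      ring

/-! ### The Meijer G-function as a loop integral -/

theorem differentiableAt_list_prod_map {ι : Type*} {f : ι → ℂ → ℂ} {s : ℂ} {l : List ι}
    (h : ∀ i ∈ l, DifferentiableAt ℂ (f i) s) :
    DifferentiableAt ℂ (fun s => (l.map fun i => f i s).prod) s := by
  induction l with
  | nil => simp
  | cons i l ih =>
    simp only [List.map_cons, List.prod_cons]
    exact (h i (by simp)).mul (ih fun j hj => h j (by simp [hj]))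

theorem inv_list_prod_map {ι : Type*} (f : ι → ℂ) (l : List ι) :
    ((l.map f).prod)⁻¹ = (l.map fun i => (f i)⁻¹).prod := by
  induction l with
  | nil => simp
  | cons i l ih => simp only [List.map_cons, List.prod_cons, mul_inv, ih]

theorem differentiableAt_meijerIntegrand {m n : ℕ} {a b : List ℂ} {z s : ℂ} (hz : z ≠ 0)
    (hb : ∀ β ∈ b.take m, ∀ k : ℕ, β - s ≠ -k) (ha : ∀ α ∈ a.take n, ∀ k : ℕ, 1 - α + s ≠ -k) :
    DifferentiableAt ℂ (meijerIntegrand m n a b z) s := by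
  -- Since 1/Γ is entire, the denominator written as a product of reciprocals imposes no condition
  -- on s.
  have e : meijerIntegrand m n a b z = fun s =>
      (((b.take m).map fun β => Gamma (β - s)).prod *
        ((a.take n).map fun α => Gamma (1 - α + s)).prod)
      * (((b.drop m).map fun β => (Gamma (1 - β + s))⁻¹).prod *
        ((a.drop n).map fun α => (Gamma (α - s))⁻¹).prod) * z ^ s := by
    ext s
    rw [meijerIntegrand, div_eq_mul_inv, mul_inv, inv_list_prod_map, inv_list_prod_map]
  rw [e]
  refine ((DifferentiableAt.mul ?_ ?_).mul (DifferentiableAt.mul ?_ ?_)).mul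
    (DifferentiableAt.const_cpow differentiableAt_id (Or.inl hz))
  · refine differentiableAt_list_prod_map (f := fun β s => Gamma (β - s)) fun β hβ => ?_
    exact (differentiableAt_Gamma _ (hb β hβ)).comp s (by fun_prop)
  · refine differentiableAt_list_prod_map (f := fun α s => Gamma (1 - α + s)) fun α hα => ?_
    exact (differentiableAt_Gamma _ (ha α hα)).comp s (by fun_prop)
  · refine differentiableAt_list_prod_map (f := fun β s => (Gamma (1 - β + s))⁻¹) fun β _ => ?_
    exact (differentiable_one_div_Gamma.differentiableAt (x := 1 - β + s)).comp s
      (by fun_prop)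
  · refine differentiableAt_list_prod_map (f := fun α s => (Gamma (α - s))⁻¹) fun β _ => ?_
    exact (differentiable_one_div_Gamma.differentiableAt (x := β - s)).comp s (by fun_prop)

theorem differentiableAt_meijerIntegrand_of_re {m : ℕ} {a b : List ℂ} {z s : ℂ} (hz : z ≠ 0)
    (hb : ∀ β ∈ b.take m, s.re < β.re) (ha : ∀ α ∈ a, α.re - 1 < s.re) :
    DifferentiableAt ℂ (meijerIntegrand m a.length a b z) s := by
  refine differentiableAt_meijerIntegrand hz (fun β hβ k hk => ?_) (fun α hα k hk => ?_)
  · have h1 := congrArg re hk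
    have h2 := hb β hβ
    simp at h1
    have : (0 : ℝ) ≤ k := Nat.cast_nonneg k
    linarith
  · rw [List.take_length] at hα
    have h1 := congrArg re hk
    have h2 := ha α hα
    simp at h1
    have : (0 : ℝ) ≤ k := Nat.cast_nonneg k
    linarith

theorem differentiableAt_meijerIntegrand_of_im {m : ℕ} {a b : List ℂ} {z s : ℂ} (hz : z ≠ 0)
    (hb : meijerHeight m b ≤ |s.im|) (ha : ∀ α ∈ a, α.re - 1 < s.re) :
    DifferentiableAt ℂ (meijerIntegrand m a.length a b z) s := by
  refine differentiableAt_meijerIntegrand hz (fun β hβ k hk => ?_) (fun α hα k hk => ?_)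
  · have h1 := congrArg im hk
    have h2 := lt_of_meijerHeight_le hb β hβ
    simp at h1
    have h3 : β.im = s.im := by linarith
    rw [h3] at h2
    linarith
  · rw [List.take_length] at hα
    have h1 := congrArg re hk
    have h2 := ha α hα
    simp at h1
    have : (0 : ℝ) ≤ k := Nat.cast_nonneg k
    linarith

theorem integrableOn_meijerIntegrand_ray {m : ℕ} {a b : List ℂ} (hm : m ≤ b.length)
    (hab : a.length < b.length) {C : ℝ} (ha : ∀ α ∈ a, α.re - 1 < C) {z : ℂ} (hz : z ≠ 0) {y : ℝ}
    (hy : meijerHeight m b ≤ |y|) :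
    IntegrableOn (fun x : ℝ => meijerIntegrand m a.length a b z ((x : ℂ) + (y : ℂ) * I))
      (Ioi C) := by
  -- Im s is fixed on the ray, so the vertical rate is immaterial and any admissible κ will do.
  obtain ⟨M, h⟩ := exists_norm_meijerIntegrand_le hm hab ha hz (lt_add_one _) 1
  refine integrableOn_of_norm_le_exp (ε := 1) (M := M * Real.exp ((|arg z| -
    ((m : ℝ) + (a.length : ℝ) - ((a.length : ℝ) + (b.length : ℝ)) / 2) * Real.pi + 1) * |y|))
    one_pos (fun x hx => ?_) (fun x hx => ?_)
  · refine ContinuousAt.continuousWithinAt ?_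
    refine ContinuousAt.comp (g := meijerIntegrand m a.length a b z) ?_
      (Continuous.continuousAt (by fun_prop))
    refine (differentiableAt_meijerIntegrand_of_im hz (by simpa using hy)
      fun α hα => ?_).continuousAt
    have := ha α hα
    have : C ≤ x := hx
    simp; linarith
  · simpa using h ((x : ℂ) + (y : ℂ) * I) (by simpa using hx) (by simpa using hy)

theorem loopIntegral_meijerIntegrand_shift_of_le {m : ℕ} {a b : List ℂ} (hm : m ≤ b.length)
    (hab : a.length < b.length) {C C' : ℝ} (hCC : C ≤ C') (ha : ∀ α ∈ a, α.re - 1 < C)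
    (hb : ∀ β ∈ b.take m, C' < β.re) {z : ℂ} (hz : z ≠ 0) :
    loopIntegral (meijerIntegrand m a.length a b z) C (meijerHeight m b)
      = loopIntegral (meijerIntegrand m a.length a b z) C' (meijerHeight m b) := by
  have hR := meijerHeight_pos m b
  refine loopIntegral_shift hCC hR.le (fun s hs => ?_) ?_ ?_
  · refine (differentiableAt_meijerIntegrand_of_re hz (fun β hβ => ?_)
      fun α hα => ?_).differentiableWithinAt
    · exact hs.1.2.trans_lt (hb β hβ)
    · exact (ha α hα).trans_le hs.1.1
  · exact integrableOn_meijerIntegrand_ray hm hab ha hz (le_abs_self _)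
  · have := integrableOn_meijerIntegrand_ray hm hab ha hz (y := -meijerHeight m b)
      (by rw [abs_neg]; exact le_abs_self _)
    simpa [← sub_eq_add_neg] using this

theorem loopIntegral_meijerIntegrand_eq {m : ℕ} {a b : List ℂ} (hm : m ≤ b.length)
    (hab : a.length < b.length) {C C' : ℝ} (hC : MeijerSeparates m a.length a b C)
    (hC' : MeijerSeparates m a.length a b C') {z : ℂ} (hz : z ≠ 0) :
    loopIntegral (meijerIntegrand m a.length a b z) C (meijerHeight m b)
      = loopIntegral (meijerIntegrand m a.length a b z) C' (meijerHeight m b) := by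
  unfold MeijerSeparates at hC hC'
  rw [List.take_length] at hC hC'
  rcases le_total C C' with h | h
  · exact loopIntegral_meijerIntegrand_shift_of_le hm hab h hC.2 hC'.1 hz
  · exact (loopIntegral_meijerIntegrand_shift_of_le hm hab h hC'.2 hC.1 hz).symm

theorem lineIntegral_meijerIntegrand_eq {m : ℕ} {a b : List ℂ} (hm : m ≤ b.length)
    (hab : a.length < b.length) {C : ℝ} (hC : MeijerSeparates m a.length a b C) {z : ℂ} (hz : z ≠ 0)
    (harg : |arg z| < ((m : ℝ) + (a.length : ℝ) - ((a.length : ℝ) + (b.length : ℝ)) / 2) * Real.pi) :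
    lineIntegral (meijerIntegrand m a.length a b z) C
      = loopIntegral (meijerIntegrand m a.length a b z) C (meijerHeight m b) := by
  unfold MeijerSeparates at hC
  rw [List.take_length] at hC
  -- The condition on arg z leaves room for a negative vertical rate κ; ρ = -κ then gives the same
  -- decay rate in both directions.
  obtain ⟨κ, h1, h2⟩ := exists_between (sub_neg.2 harg)
  obtain ⟨M, h⟩ := exists_norm_meijerIntegrand_le hm hab hC.2 hz h1 (-κ)
  refine lineIntegral_eq_loopIntegral (ε := -κ) (M := M) (by linarith) (meijerHeight_pos m b).le
    (fun s hs => ?_) (fun s hs => ?_) (fun s h3 h4 => ?_)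
  · exact (differentiableAt_meijerIntegrand_of_im hz hs.2 fun α hα =>
      (hC.2 α hα).trans_le hs.1).differentiableWithinAt
  · have hs' : s.re = C := hs
    exact (differentiableAt_meijerIntegrand_of_re hz (by rw [hs']; exact hC.1)
      (by rw [hs']; exact hC.2)).continuousAt.continuousWithinAt
  · simpa using h s h3 h4

/-- A Meijer G-function with `n = p < q` is the integral over a loop with any separating abscissa. -/
theorem meijerG_eq_loopIntegral {m : ℕ} {a b : List ℂ} (hm : m ≤ b.length)
    (hab : a.length < b.length) {C : ℝ} (hC : MeijerSeparates m a.length a b C) {z : ℂ}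
    (hz : z ≠ 0) :
    meijerG m a.length a b z
      = loopIntegral (meijerIntegrand m a.length a b z) C (meijerHeight m b) := by
  have hA : MeijerSeparates m a.length a b (meijerAbscissa m a.length a b) :=
    Classical.epsilon_spec (p := fun C : ℝ => MeijerSeparates m a.length a b C) ⟨C, hC⟩
  unfold meijerG
  split_ifs with h
  · rw [lineIntegral_meijerIntegrand_eq hm hab hA hz h,
      loopIntegral_meijerIntegrand_eq hm hab hA hC hz]
  · exact loopIntegral_meijerIntegrand_eq hm hab hA hC hz

/-! ### Mellin transforms of Bessel functions under a contour integral -/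

theorem aestronglyMeasurable_besselK (μ : ℂ) :
    AEStronglyMeasurable (fun t : ℝ => besselK μ t) (volume.restrict (Ioi 0)) := by
  have h : StronglyMeasurable
      (fun t : ℝ => 1 / 2 * ∫ u : ℝ, cexp (-(t * cosh u) - μ * u)) := by
    refine StronglyMeasurable.const_mul ?_ _
    refine StronglyMeasurable.integral_prod_right (Continuous.stronglyMeasurable ?_)
    unfold Function.uncurry
    fun_prop
  refine h.aestronglyMeasurable.congr ?_
  exact (ae_restrict_iff' measurableSet_Ioi).2 (.of_forall fun t ht =>
    (besselK_eq_integral (mem_Ioi.1 ht) μ).symm)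

/-- Fubini on one side of the loop, parametrised by γ. The last hypothesis has Gamma at real
arguments because that is the majorant of the inner absolute integral. -/
theorem besselK_mellin_integral {μ l : ℂ} {γ : ℝ → ℂ} {S : Set ℝ} (hS : MeasurableSet S)
    (hγ : Continuous γ) {F : ℂ → ℂ} (hF : AEStronglyMeasurable (fun p => F (γ p)) (volume.restrict S))
    (hre : ∀ p ∈ S, |μ.re| < (l + 2 * γ p + 1).re)
    (hint : IntegrableOn (fun p => F (γ p) * ((2 : ℂ) ^ (((l + 2 * γ p + 1).re : ℂ) - 2)
      * Gamma ((((l + 2 * γ p + 1).re : ℂ) - μ.re) / 2)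
      * Gamma ((((l + 2 * γ p + 1).re : ℂ) + μ.re) / 2))) S) :
    IntegrableOn (fun t : ℝ => besselK μ t * (t : ℂ) ^ l * ∫ p in S, F (γ p) * (t : ℂ) ^ (2 * γ p))
      (Ioi 0) ∧
    ∫ t : ℝ in Ioi 0, besselK μ t * (t : ℂ) ^ l * ∫ p in S, F (γ p) * (t : ℂ) ^ (2 * γ p)
      = ∫ p in S, F (γ p) * ((2 : ℂ) ^ (l + 2 * γ p + 1 - 2)
        * Gamma ((l + 2 * γ p + 1 - μ) / 2) * Gamma ((l + 2 * γ p + 1 + μ) / 2)) := by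
  set H : ℝ → ℝ → ℂ := fun t p => F (γ p) * ((t : ℂ) ^ (l + 2 * γ p + 1 - 1) * besselK μ t) with hH
  have hm : AEStronglyMeasurable (Function.uncurry H)
      ((volume.restrict (Ioi 0)).prod (volume.restrict S)) := by
    have h1 : AEStronglyMeasurable (fun q : ℝ × ℝ => F (γ q.2))
        ((volume.restrict (Ioi 0)).prod (volume.restrict S)) := hF.comp_snd
    have h2 : AEStronglyMeasurable (fun q : ℝ × ℝ => besselK μ q.1)
        ((volume.restrict (Ioi 0)).prod (volume.restrict S)) :=
      (aestronglyMeasurable_besselK μ).comp_fst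
    have h3 : Measurable (fun q : ℝ × ℝ => (q.1 : ℂ) ^ (l + 2 * γ q.2 + 1 - 1)) := by
      have := hγ.measurable
      fun_prop
    exact h1.mul (h3.aestronglyMeasurable.mul h2)
  have hi : Integrable (Function.uncurry H)
      ((volume.restrict (Ioi 0)).prod (volume.restrict S)) := by
    rw [integrable_prod_iff' hm]
    constructor
    · exact (ae_restrict_iff' hS).2 (.of_forall fun p hp =>
        (besselK_mellin (hre p hp)).1.const_mul (F (γ p)))
    · refine hint.norm.mono' hm.norm.prod_swap.integral_prod_right' ?_
      refine (ae_restrict_iff' hS).2 (.of_forall fun p hp => ?_)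
      rw [Real.norm_of_nonneg (integral_nonneg fun _ => norm_nonneg _)]
      simp only [Function.uncurry_apply_pair, hH]
      simp only [norm_mul (F _), integral_const_mul]
      exact mul_le_mul_of_nonneg_left (integral_norm_besselK_le (hre p hp)) (norm_nonneg _)
  have e : ∀ t ∈ Ioi (0 : ℝ), besselK μ t * (t : ℂ) ^ l * ∫ p in S, F (γ p) * (t : ℂ) ^ (2 * γ p)
      = ∫ p in S, H t p := fun t ht => by
    have ht0 : (t : ℂ) ≠ 0 := by exact_mod_cast (mem_Ioi.1 ht).ne'
    rw [← integral_const_mul]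
    congr 1
    ext p
    simp only [hH]
    rw [add_sub_cancel_right, cpow_add _ _ ht0]
    ring
  constructor
  · rw [integrableOn_congr_fun e measurableSet_Ioi]
    exact hi.integral_prod_left
  · rw [setIntegral_congr_fun measurableSet_Ioi e, integral_integral_swap hi]
    refine setIntegral_congr_fun hS fun p hp => ?_
    simp only [hH]
    rw [integral_const_mul, (besselK_mellin (hre p hp)).2]

theorem loopIntegral_congr {F G : ℂ → ℂ} {C R : ℝ}
    (h : ∀ s : ℂ, C ≤ s.re → F s = G s) : loopIntegral F C R = loopIntegral G C R := by
  have h1 : ∀ x ∈ Ioi C, F ((x : ℂ) - (R : ℂ) * I) = G ((x : ℂ) - (R : ℂ) * I) :=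
    fun x hx => h _ (by simpa using (mem_Ioi.1 hx).le)
  have h2 : ∀ x ∈ Ioi C, F ((x : ℂ) + (R : ℂ) * I) = G ((x : ℂ) + (R : ℂ) * I) :=
    fun x hx => h _ (by simpa using (mem_Ioi.1 hx).le)
  have h3 : ∀ y : ℝ, F ((C : ℂ) + (y : ℂ) * I) = G ((C : ℂ) + (y : ℂ) * I) :=
    fun y => h _ (by simp)
  unfold loopIntegral
  rw [setIntegral_congr_fun measurableSet_Ioi h1, setIntegral_congr_fun measurableSet_Ioi h2]
  simp only [h3]

theorem integral_loop_combination {α : Type*} [MeasurableSpace α] {ρ : Measure α} {f g h : α → ℂ}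
    (hf : Integrable f ρ) (hg : Integrable g ρ) (hh : Integrable h ρ) (c : ℂ) :
    Integrable (fun x => c * (-f x + I * g x + h x)) ρ ∧
    ∫ x, c * (-f x + I * g x + h x) ∂ρ
      = c * (-(∫ x, f x ∂ρ) + I * (∫ x, g x ∂ρ) + ∫ x, h x ∂ρ) := by
  have h1 : Integrable (fun x => -f x) ρ := hf.neg
  have h2 : Integrable (fun x => I * g x) ρ := hg.const_mul I
  have h3 : Integrable (fun x => -f x + I * g x) ρ := h1.add h2
  refine ⟨(h3.add hh).const_mul c, ?_⟩
  rw [integral_const_mul, integral_add h3 hh, integral_add h1 h2, integral_neg, integral_const_mul]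

/-- A loop integral of powers, integrated against a Bessel function. -/
theorem besselK_mellin_loopIntegral {μ l : ℂ} {F : ℂ → ℂ} {C R : ℝ} (hR : 0 ≤ R)
    (hC : |μ.re| < l.re + 2 * C + 1)
    (hu : AEStronglyMeasurable (fun p : ℝ => F ((p : ℂ) + (R : ℂ) * I)) (volume.restrict (Ioi C)))
    (hl : AEStronglyMeasurable (fun p : ℝ => F ((p : ℂ) - (R : ℂ) * I)) (volume.restrict (Ioi C)))
    (hv : ContinuousOn (fun y : ℝ => F ((C : ℂ) + (y : ℂ) * I)) (Icc (-R) R))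
    (hui : IntegrableOn (fun p : ℝ => F ((p : ℂ) + (R : ℂ) * I)
      * ((2 : ℂ) ^ (((l.re + 2 * p + 1 : ℝ) : ℂ) - 2)
      * Gamma ((((l.re + 2 * p + 1 : ℝ) : ℂ) - μ.re) / 2)
      * Gamma ((((l.re + 2 * p + 1 : ℝ) : ℂ) + μ.re) / 2))) (Ioi C))
    (hli : IntegrableOn (fun p : ℝ => F ((p : ℂ) - (R : ℂ) * I)
      * ((2 : ℂ) ^ (((l.re + 2 * p + 1 : ℝ) : ℂ) - 2)
      * Gamma ((((l.re + 2 * p + 1 : ℝ) : ℂ) - μ.re) / 2)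
      * Gamma ((((l.re + 2 * p + 1 : ℝ) : ℂ) + μ.re) / 2))) (Ioi C)) :
    IntegrableOn (fun t : ℝ => besselK μ t * (t : ℂ) ^ l *
      loopIntegral (fun s => F s * (t : ℂ) ^ (2 * s)) C R) (Ioi 0) ∧
    ∫ t : ℝ in Ioi 0, besselK μ t * (t : ℂ) ^ l *
      loopIntegral (fun s => F s * (t : ℂ) ^ (2 * s)) C R
      = loopIntegral (fun s => F s * ((2 : ℂ) ^ (l + 2 * s + 1 - 2)
        * Gamma ((l + 2 * s + 1 - μ) / 2) * Gamma ((l + 2 * s + 1 + μ) / 2))) C R := by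
  have eu : ∀ p : ℝ, (l + 2 * ((p : ℂ) + (R : ℂ) * I) + 1).re = l.re + 2 * p + 1 := by simp
  have el : ∀ p : ℝ, (l + 2 * ((p : ℂ) - (R : ℂ) * I) + 1).re = l.re + 2 * p + 1 := by simp
  have ev : ∀ p : ℝ, (l + 2 * ((C : ℂ) + (p : ℂ) * I) + 1).re = l.re + 2 * C + 1 := by simp
  obtain ⟨u1, u2⟩ := besselK_mellin_integral (μ := μ) (l := l) (F := F)
    (γ := fun p : ℝ => (p : ℂ) + (R : ℂ) * I) measurableSet_Ioi (by fun_prop) hu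
    (fun p hp => by
      rw [eu]; have := mem_Ioi.1 hp; linarith) (by simpa only [eu] using hui)
  obtain ⟨l1, l2⟩ := besselK_mellin_integral (μ := μ) (l := l) (F := F)
    (γ := fun p : ℝ => (p : ℂ) - (R : ℂ) * I) measurableSet_Ioi (by fun_prop) hl
    (fun p hp => by
      rw [el]; have := mem_Ioi.1 hp; linarith) (by simpa only [el] using hli)
  have hvi : IntegrableOn (fun y : ℝ => F ((C : ℂ) + (y : ℂ) * I)) (Ioc (-R) R) :=
    (hv.integrableOn_compact isCompact_Icc).mono_set Ioc_subset_Icc_self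
  obtain ⟨v1, v2⟩ := besselK_mellin_integral (μ := μ) (l := l) (F := F)
    (γ := fun y : ℝ => (C : ℂ) + (y : ℂ) * I) measurableSet_Ioc (by fun_prop)
    hvi.aestronglyMeasurable (fun p hp => by rw [ev]; exact hC)
    (by simp only [ev]; exact hvi.mul_const _)
  have hRR : -R ≤ R := by linarith
  have e : ∀ t : ℝ, besselK μ t * (t : ℂ) ^ l *
      loopIntegral (fun s => F s * (t : ℂ) ^ (2 * s)) C R
      = (2 * (Real.pi : ℂ) * I)⁻¹ *
        (-(besselK μ t * (t : ℂ) ^ l * ∫ p : ℝ in Ioi C, F ((p : ℂ) - (R : ℂ) * I)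
            * (t : ℂ) ^ (2 * ((p : ℂ) - (R : ℂ) * I)))
          + I * (besselK μ t * (t : ℂ) ^ l * ∫ y : ℝ in Ioc (-R) R, F ((C : ℂ) + (y : ℂ) * I)
            * (t : ℂ) ^ (2 * ((C : ℂ) + (y : ℂ) * I)))
          + besselK μ t * (t : ℂ) ^ l * ∫ p : ℝ in Ioi C, F ((p : ℂ) + (R : ℂ) * I)
            * (t : ℂ) ^ (2 * ((p : ℂ) + (R : ℂ) * I))) := by
    intro t
    rw [loopIntegral, intervalIntegral.integral_of_le hRR]
    ring
  simp only [e]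
  obtain ⟨c1, c2⟩ := integral_loop_combination l1 v1 u1 (2 * (Real.pi : ℂ) * I)⁻¹
  refine ⟨c1, c2.trans ?_⟩
  rw [l2, v2, u2, loopIntegral, intervalIntegral.integral_of_le hRR]

/-! ### The Bessel transform of a Meijer G-function -/

theorem ofReal_mul_cpow_of_pos {r : ℝ} (hr : 0 < r) {z : ℂ} (hz : z ≠ 0) (s : ℂ) :
    ((r : ℂ) * z) ^ s = (r : ℂ) ^ s * z ^ s := by
  have hr0 : (r : ℂ) ≠ 0 := by exact_mod_cast hr.ne'
  rw [cpow_def_of_ne_zero (mul_ne_zero hr0 hz), cpow_def_of_ne_zero hr0, cpow_def_of_ne_zero hz,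
    log_ofReal_mul hr hz, ofReal_log hr.le, ← Complex.exp_add, add_mul]

/-- A positive factor leaves arg z unchanged, so the power splits on the principal branch for every
nonzero z, even on the cut. -/
theorem meijerIntegrand_mul_sq {m n : ℕ} {a b : List ℂ} {t : ℝ} (ht : 0 < t) {z : ℂ} (hz : z ≠ 0)
    (s : ℂ) : meijerIntegrand m n a b ((t : ℂ) ^ 2 * z) s
      = meijerIntegrand m n a b z s * (t : ℂ) ^ (2 * s) := by
  have e : (t : ℂ) ^ (2 * s) = ((t : ℂ) ^ 2) ^ s := by
    have ht0 : (t : ℂ) ≠ 0 := by exact_mod_cast ht.ne'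
    have ht2 : ((t ^ 2 : ℝ) : ℂ) ≠ 0 := by exact_mod_cast (pow_pos ht 2).ne'
    rw [← ofReal_pow, cpow_def_of_ne_zero ht0, cpow_def_of_ne_zero ht2, ← ofReal_log ht.le,
      ← ofReal_log (by positivity), Real.log_pow]
    push_cast
    ring_nf
  unfold meijerIntegrand
  rw [e, ← ofReal_pow, ofReal_mul_cpow_of_pos (by positivity) hz]
  ring

theorem meijerIntegrand_two_four_mul (m : ℕ) (α α' : ℂ) (b : List ℂ) {z : ℂ} (hz : z ≠ 0) (s : ℂ) :
    meijerIntegrand m 2 [α, α'] b (4 * z) s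
      = meijerIntegrand m 0 [] b z s * (Gamma (1 - α + s) * Gamma (1 - α' + s) * (2 : ℂ) ^ (2 * s)) := by
  have e : (4 * z) ^ s = (2 : ℂ) ^ (2 * s) * z ^ s := by
    have h1 := ofReal_mul_cpow_of_pos (show (0 : ℝ) < 4 by norm_num) hz s
    rw [show (4 : ℂ) = ((4 : ℝ) : ℂ) by norm_num, h1]
    congr 1
    have := meijerIntegrand_mul_sq (m := 0) (n := 0) (a := []) (b := []) (t := 2) two_pos one_ne_zero s
    simp only [meijerIntegrand, mul_one] at this
    norm_num at this ⊢
    exact this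
  unfold meijerIntegrand
  rw [e]
  simp
  ring

/-- Up to a constant this is the integrand of a G-function at 4z with two upper parameters, so q > 2
gives convergence. It supplies the majorant on the two rays. -/
theorem integrableOn_meijerIntegrand_mul_Gamma {b : List ℂ} {m : ℕ} (hm : m ≤ b.length)
    (hb : 2 < b.length) {C c c' : ℝ} (hc : 0 < C + c) (hc' : 0 < C + c') {z : ℂ} (hz : z ≠ 0) {y : ℝ}
    (hy : meijerHeight m b ≤ |y|) (l : ℝ) :
    IntegrableOn (fun x : ℝ => meijerIntegrand m 0 [] b z ((x : ℂ) + (y : ℂ) * I)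
      * ((2 : ℂ) ^ ((l + 2 * x : ℝ) : ℂ) * Gamma ((x + c : ℝ) : ℂ) * Gamma ((x + c' : ℝ) : ℂ)))
      (Ioi C) := by
  -- The imaginary part y of the parameters cancels that of s on the ray, so the new Gammas sit at
  -- the real points x + c and x + c'.
  have h := integrableOn_meijerIntegrand_ray (a := [((1 - c : ℝ) : ℂ) + y * I, ((1 - c' : ℝ) : ℂ) + y * I])
    hm hb (C := C) (by simp; constructor <;> linarith) (z := 4 * z) (by simpa using hz) hy
  have h' := h.mul_const ((2 : ℂ) ^ (l - 2 * (y * I)))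
  refine h'.congr (.of_forall fun x => ?_)
  simp only [List.length_cons, List.length_nil, zero_add, Nat.reduceAdd]
  rw [meijerIntegrand_two_four_mul _ _ _ _ hz]
  have e : (2 : ℂ) ^ ((l + 2 * x : ℝ) : ℂ)
      = (2 : ℂ) ^ (2 * ((x : ℂ) + y * I)) * (2 : ℂ) ^ (l - 2 * (y * I)) := by
    rw [← cpow_add _ _ two_ne_zero]
    congr 1
    push_cast; ring
  rw [e, show 1 - (((1 - c : ℝ) : ℂ) + y * I) + ((x : ℂ) + y * I) = ((x + c : ℝ) : ℂ) by
      push_cast; ring,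
    show 1 - (((1 - c' : ℝ) : ℂ) + y * I) + ((x : ℂ) + y * I) = ((x + c' : ℝ) : ℂ) by
      push_cast; ring]
  ring

theorem besselK_meijerG_integral {b₁ b₂ : List ℂ} (hlen : 2 ≤ b₁.length + b₂.length)
    {μ ν x : ℂ} (hx : x ≠ 0) {C : ℝ} (hC : ∀ β ∈ b₁, C < β.re) (hν : 0 < C + (1 + ν.re) / 2)
    (hμ : 0 < C + (1 + 2 * μ.re + ν.re) / 2) :
    IntegrableOn (fun t : ℝ => besselK μ t * (t : ℂ) ^ (μ + ν) *
      meijerG b₁.length 0 [] (b₁ ++ (1 - ν) / 2 :: b₂) ((x * t) ^ 2 / 16)) (Ioi 0) ∧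
    ∫ t : ℝ in Ioi 0, besselK μ t * (t : ℂ) ^ (μ + ν) *
      meijerG b₁.length 0 [] (b₁ ++ (1 - ν) / 2 :: b₂) ((x * t) ^ 2 / 16)
      = (2 : ℂ) ^ (μ + ν - 1) *
        meijerG b₁.length 1 [(1 - 2 * μ - ν) / 2] (b₁ ++ b₂) (x ^ 2 / 4) := by
  set b := b₁ ++ (1 - ν) / 2 :: b₂ with hbdef
  set m := b₁.length with hmdef
  set R := meijerHeight m b with hRdef
  set z := x ^ 2 / 16 with hzdef
  have hz : z ≠ 0 := by simpa [hzdef] using hx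
  have hm : m ≤ b.length := by simp [hbdef, hmdef]
  have hb : 2 < b.length := by simp [hbdef]; omega
  have hR : 0 < R := meijerHeight_pos m b
  have htake : b.take m = b₁ := by simp [hbdef, hmdef]
  have hdrop : b.drop m = (1 - ν) / 2 :: b₂ := by simp [hbdef, hmdef]
  have htake' : (b₁ ++ b₂).take m = b₁ := by simp [hmdef]
  have hdrop' : (b₁ ++ b₂).drop m = b₂ := by simp [hmdef]
  have hR' : meijerHeight m (b₁ ++ b₂) = R := by
    rw [hRdef, meijerHeight, meijerHeight, htake, htake']
  have hsep : MeijerSeparates m ([] : List ℂ).length [] b C := ⟨by rwa [htake], by simp⟩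
  have hsep' : MeijerSeparates m [(1 - 2 * μ - ν) / 2].length [(1 - 2 * μ - ν) / 2] (b₁ ++ b₂) C := by
    refine ⟨by rwa [htake'], ?_⟩
    have : ((1 - 2 * μ - ν) / 2).re = (1 - 2 * μ.re - ν.re) / 2 := by simp
    simp [this]; linarith
  have hkernel : ∀ t ∈ Ioi (0 : ℝ), besselK μ t * (t : ℂ) ^ (μ + ν) *
      meijerG m 0 [] b ((x * t) ^ 2 / 16) = besselK μ t * (t : ℂ) ^ (μ + ν) *
      loopIntegral (fun s => meijerIntegrand m 0 [] b z s * (t : ℂ) ^ (2 * s)) C R := by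
    intro t ht
    have ht0 : (t : ℂ) ≠ 0 := by exact_mod_cast (mem_Ioi.1 ht).ne'
    have e : (x * t) ^ 2 / 16 = (t : ℂ) ^ 2 * z := by rw [hzdef]; ring
    have h := meijerG_eq_loopIntegral hm (by simp; omega) hsep (mul_ne_zero (pow_ne_zero 2 ht0) hz)
    rw [List.length_nil] at h
    rw [e, h, funext (meijerIntegrand_mul_sq (mem_Ioi.1 ht) hz)]
  have hray : ∀ y : ℝ, |y| = R → IntegrableOn
      (fun p : ℝ => meijerIntegrand m 0 [] b z ((p : ℂ) + (y : ℂ) * I)) (Ioi C) := fun y hy =>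
    integrableOn_meijerIntegrand_ray (a := []) hm (by simp; omega) (by simp) hz hy.ge
  have hray' : ∀ y : ℝ, |y| = R → IntegrableOn
      (fun p : ℝ => meijerIntegrand m 0 [] b z ((p : ℂ) + (y : ℂ) * I)
      * ((2 : ℂ) ^ ((((μ + ν).re + 2 * p + 1 : ℝ) : ℂ) - 2)
      * Gamma (((((μ + ν).re + 2 * p + 1 : ℝ) : ℂ) - μ.re) / 2)
      * Gamma (((((μ + ν).re + 2 * p + 1 : ℝ) : ℂ) + μ.re) / 2))) (Ioi C) := by
    intro y hy
    refine (integrableOn_meijerIntegrand_mul_Gamma hm hb hν hμ hz hy.ge ((μ + ν).re - 1)).congr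
      (.of_forall fun p => ?_)
    simp only [add_re]
    congr 3 <;> [congr 1; congr 1; skip] <;> push_cast <;> ring_nf
  obtain ⟨h1, h2⟩ := besselK_mellin_loopIntegral (μ := μ) (l := μ + ν) (C := C) hR.le
    (F := meijerIntegrand m 0 [] b z)
    -- The two halves of |Re μ| < Re(μ+ν) + 2C + 1 are exactly `hμ` and `hν`, doubled.
    (by rw [add_re, abs_lt]; constructor <;> linarith)
    (hray R (abs_of_pos hR)).aestronglyMeasurable
    (by simpa [← sub_eq_add_neg] using
      (hray (-R) (by rw [abs_neg, abs_of_pos hR])).aestronglyMeasurable)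
    (fun y _ => by
      refine ContinuousAt.continuousWithinAt (ContinuousAt.comp (g := meijerIntegrand m 0 [] b z) ?_
        (Continuous.continuousAt (by fun_prop)))
      exact (differentiableAt_meijerIntegrand_of_re (a := []) hz
        (by rw [htake]; simpa using hC) (by simp)).continuousAt)
    (hray' R (abs_of_pos hR))
    (by simpa [← sub_eq_add_neg] using hray' (-R) (by rw [abs_neg, abs_of_pos hR]))
  constructor
  · exact (integrableOn_congr_fun hkernel measurableSet_Ioi).2 h1
  · rw [setIntegral_congr_fun measurableSet_Ioi hkernel, h2]
    have hz4 : x ^ 2 / 4 ≠ 0 := by simpa using hx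
    have h := meijerG_eq_loopIntegral (z := x ^ 2 / 4) (by simp [hmdef]) (by simp; omega) hsep' hz4
    rw [List.length_singleton, hR'] at h
    have hcomm : (2 : ℂ) ^ (μ + ν - 1) *
        loopIntegral (meijerIntegrand m 1 [(1 - 2 * μ - ν) / 2] (b₁ ++ b₂) (x ^ 2 / 4)) C R
        = loopIntegral (fun s => (2 : ℂ) ^ (μ + ν - 1) *
          meijerIntegrand m 1 [(1 - 2 * μ - ν) / 2] (b₁ ++ b₂) (x ^ 2 / 4) s) C R := by
      unfold loopIntegral
      simp only [integral_const_mul, intervalIntegral.integral_const_mul]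
      ring
    rw [h, hcomm]
    refine loopIntegral_congr fun s hs => ?_
    -- This Gamma comes from the Mellin transform and also stands in the denominator; cancelling it
    -- requires that it not vanish.
    have hG : Gamma ((1 + ν) / 2 + s) ≠ 0 := Gamma_ne_zero_of_re_pos (by
      have : ((1 + ν) / 2 + s).re = (1 + ν.re) / 2 + s.re := by simp
      rw [this]; linarith)
    have hz' : x ^ 2 / 4 = ((2 : ℝ) : ℂ) ^ 2 * z := by rw [hzdef]; push_cast; ring
    rw [hz', meijerIntegrand_mul_sq two_pos hz]
    have e1 : (2 : ℂ) ^ (μ + ν + 2 * s + 1 - 2) = (2 : ℂ) ^ (μ + ν - 1) * (2 : ℂ) ^ (2 * s) := by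
      rw [← cpow_add _ _ two_ne_zero]; ring_nf
    unfold meijerIntegrand
    rw [htake, htake', hdrop, hdrop', e1]
    simp only [List.map_cons, List.prod_cons, List.take_succ_cons, List.map_nil,
      List.prod_nil, List.drop_nil, List.drop_succ_cons, List.take_nil, mul_one]
    rw [show (μ + ν + 2 * s + 1 - μ) / 2 = (1 + ν) / 2 + s by ring,
      show (μ + ν + 2 * s + 1 + μ) / 2 = 1 - (1 - 2 * μ - ν) / 2 + s by ring,
      show 1 - (1 - ν) / 2 + s = (1 + ν) / 2 + s by ring, ofReal_ofNat]
    generalize Gamma ((1 + ν) / 2 + s) = G at hG ⊢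
    generalize Gamma (1 - (1 - 2 * μ - ν) / 2 + s) = G'
    field_simp

/-! ### Specialisation to the Koshliakov kernel -/

theorem besselK_neg (ν : ℂ) {t : ℝ} (ht : 0 < t) : besselK (-ν) t = besselK ν t := by
  rw [besselK_eq_integral ht, besselK_eq_integral ht,
    ← integral_neg_eq_self (fun u : ℝ => cexp (-(t * cosh u) - ν * u))]
  simp [cosh_neg]

/-- A parameter that occurs both in the numerator and in the denominator can be cancelled. -/
theorem meijerG_one_concat {m : ℕ} {b : List ℂ} (hm : m ≤ b.length) (hb : b ≠ []) {α z : ℂ}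
    (hz : z ≠ 0) {C : ℝ} (hC : ∀ β ∈ b.take m, C < β.re) (hα : α.re - 1 < C) :
    meijerG m 1 [α] (b ++ [α]) z = meijerG m 0 [] b z := by
  have htake : (b ++ [α]).take m = b.take m := List.take_append_of_le_length hm
  have hdrop : (b ++ [α]).drop m = b.drop m ++ [α] := List.drop_append_of_le_length hm
  have hpos : 0 < b.length := List.length_pos_iff.2 hb
  have h1 := meijerG_eq_loopIntegral (m := m) (a := [α]) (b := b ++ [α]) (C := C) (by simp; omega)
    (by simpa using hpos) ⟨by rwa [htake], by simpa using hα⟩ hz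
  have h0 := meijerG_eq_loopIntegral (m := m) (a := []) (b := b) (C := C) hm hpos
    ⟨hC, by simp⟩ hz
  have hR : meijerHeight m (b ++ [α]) = meijerHeight m b := by
    rw [meijerHeight, meijerHeight, htake]
  rw [List.length_singleton, hR] at h1
  rw [List.length_nil] at h0
  rw [h1, h0]
  refine loopIntegral_congr fun s hs => ?_
  have hG : Gamma (1 - α + s) ≠ 0 := Gamma_ne_zero_of_re_pos (by simp; linarith)
  unfold meijerIntegrand
  rw [htake, hdrop]
  simp only [List.map_append, List.prod_append, List.map_cons, List.prod_cons, List.take_succ_cons,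
    List.map_nil, List.prod_nil, List.drop_nil, List.drop_succ_cons,
    List.take_nil, mul_one]
  rw [mul_div_mul_right _ _ hG]

theorem theorem1p3 (K : Type*) [Field K] [NumberField K] (d r₁ r₂ : ℕ)
    (hd : d = Module.finrank ℚ K)
    (hr₁ : r₁ = NumberField.InfinitePlace.nrRealPlaces K)
    (hr₂ : r₂ = NumberField.InfinitePlace.nrComplexPlaces K) :
    (∀ μ ν x : ℂ, -(1 / 2 : ℝ) < μ.re → -(1 / 2 : ℝ) < ν.re → -(1 / 2 : ℝ) < (μ + ν).re → x ≠ 0 →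
      IntegrableOn
          (fun t : ℝ => besselK μ (t : ℂ) * (t : ℂ) ^ (μ + ν) * koshliakovKernel K ν (x * (t : ℂ)))
          (Ioi 0) ∧
        ∫ t : ℝ in Ioi 0,
            besselK μ (t : ℂ) * (t : ℂ) ^ (μ + ν) * koshliakovKernel K ν (x * (t : ℂ)) =
          (2 : ℂ) ^ (μ + ν - 1) *
            meijerG (d + 1) 1 [(1 - 2 * μ - ν) / 2]
              ([-ν / 2] ++ List.replicate (r₁ + r₂) (ν / 2) ++ List.replicate r₂ ((1 + ν) / 2)
                ++ List.replicate r₂ (ν / 2) ++ List.replicate (r₁ + r₂) ((1 + ν) / 2))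
              (x ^ 2 / 4)) ∧
    (∀ ν x : ℂ, -(1 / 2 : ℝ) < ν.re → ν.re < (1 / 2 : ℝ) → x ≠ 0 →
      IntegrableOn
          (fun t : ℝ => besselK ν (t : ℂ) * koshliakovKernel K ν (x * (t : ℂ))) (Ioi 0) ∧
        ∫ t : ℝ in Ioi 0, besselK ν (t : ℂ) * koshliakovKernel K ν (x * (t : ℂ)) =
          (1 / 2 : ℂ) *
            meijerG (d + 1) 0 []
              ([-ν / 2] ++ List.replicate (r₁ + r₂) (ν / 2) ++ List.replicate r₂ ((1 + ν) / 2)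
                ++ List.replicate r₂ (ν / 2) ++ List.replicate (r₁ + r₂ - 1) ((1 + ν) / 2))
              (x ^ 2 / 4)) := by
  have hdeg : d = r₁ + 2 * r₂ := by
    rw [hd, hr₁, hr₂]; exact (NumberField.InfinitePlace.card_add_two_mul_card_eq_rank K).symm
  have hd0 : 0 < d := by rw [hd]; exact Module.finrank_pos
  have hr0 : 1 ≤ r₁ + r₂ := by omega
  have main : ∀ μ ν x : ℂ, -(1 / 2 : ℝ) < μ.re → -(1 / 2 : ℝ) < ν.re →
      -(1 / 2 : ℝ) < (μ + ν).re → x ≠ 0 →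
      IntegrableOn
          (fun t : ℝ => besselK μ (t : ℂ) * (t : ℂ) ^ (μ + ν) * koshliakovKernel K ν (x * (t : ℂ)))
          (Ioi 0) ∧
        ∫ t : ℝ in Ioi 0,
            besselK μ (t : ℂ) * (t : ℂ) ^ (μ + ν) * koshliakovKernel K ν (x * (t : ℂ)) =
          (2 : ℂ) ^ (μ + ν - 1) *
            meijerG (d + 1) 1 [(1 - 2 * μ - ν) / 2]
              ([-ν / 2] ++ List.replicate (r₁ + r₂) (ν / 2) ++ List.replicate r₂ ((1 + ν) / 2)
                ++ List.replicate r₂ (ν / 2) ++ List.replicate (r₁ + r₂) ((1 + ν) / 2))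
              (x ^ 2 / 4) := by
    intro μ ν x hμ hν hμν hx
    rw [add_re] at hμν
    -- Of the four inequalities needed for C, one is automatic and the others are the lower bounds
    -- on Re ν, Re μ and Re(μ+ν). The parameter (1+ν)/2 lies to the right of ν/2 and adds no
    -- condition.
    obtain ⟨C, hC1, hC2⟩ := exists_between (show max (-((1 + ν.re) / 2))
      (-((1 + 2 * μ.re + ν.re) / 2)) < min (-ν.re / 2) (ν.re / 2) by
        rw [max_lt_iff, lt_min_iff, lt_min_iff]
        refine ⟨⟨?_, ?_⟩, ?_, ?_⟩ <;> linarith)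
    rw [max_lt_iff] at hC1
    rw [lt_min_iff] at hC2
    have key := besselK_meijerG_integral
      (b₁ := [-ν / 2] ++ List.replicate (r₁ + r₂) (ν / 2) ++ List.replicate r₂ ((1 + ν) / 2))
      (b₂ := List.replicate r₂ (ν / 2) ++ List.replicate (r₁ + r₂) ((1 + ν) / 2))
      (by simp; omega) (μ := μ) (ν := ν) hx (C := C) (by
        intro β hβ
        simp only [List.mem_append, List.mem_singleton, List.mem_replicate] at hβ
        rcases hβ with (rfl | ⟨_, rfl⟩) | ⟨_, rfl⟩ <;> simp <;> linarith)
      (by linarith) (by linarith)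
    have hlen : ([-ν / 2] ++ List.replicate (r₁ + r₂) (ν / 2)
        ++ List.replicate r₂ ((1 + ν) / 2)).length = d + 1 := by
      simp; omega
    rw [hlen] at key
    unfold koshliakovKernel
    rw [← hd, ← hr₁, ← hr₂]
    simpa only [List.append_assoc, List.singleton_append, List.cons_append, List.nil_append]
      using key
  refine ⟨main, fun ν x hν hν' hx => ?_⟩
  obtain ⟨h1, h2⟩ := main (-ν) ν x (by rw [neg_re]; linarith) hν (by simp) hx
  have e : ∀ t ∈ Ioi (0 : ℝ), besselK (-ν) (t : ℂ) * (t : ℂ) ^ (-ν + ν)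
      * koshliakovKernel K ν (x * (t : ℂ)) = besselK ν (t : ℂ) * koshliakovKernel K ν (x * (t : ℂ)) :=
    fun t ht => by rw [besselK_neg ν (mem_Ioi.1 ht), neg_add_cancel, cpow_zero, mul_one]
  refine ⟨(integrableOn_congr_fun e measurableSet_Ioi).1 h1, ?_⟩
  rw [← setIntegral_congr_fun measurableSet_Ioi e, h2]
  -- The left end is Re α - 1 for the cancelling parameter α = (1+ν)/2; here Re ν < 1/2 is used.
  obtain ⟨C, hC1, hC2⟩ := exists_between (show (ν.re - 1) / 2 < min (-ν.re / 2) (ν.re / 2) by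
    rw [lt_min_iff]; constructor <;> linarith)
  rw [lt_min_iff] at hC2
  -- A number field has at least one infinite place, so the subtraction is not truncated and a last
  -- copy of (1+ν)/2 is available to cancel.
  obtain ⟨r, hr⟩ : ∃ r, r₁ + r₂ = r + 1 := ⟨r₁ + r₂ - 1, by omega⟩
  have hcancel := meijerG_one_concat (m := d + 1) (α := (1 + ν) / 2) (z := x ^ 2 / 4) (C := C)
    (b := [-ν / 2] ++ List.replicate (r₁ + r₂) (ν / 2) ++ List.replicate r₂ ((1 + ν) / 2)
      ++ List.replicate r₂ (ν / 2) ++ List.replicate r ((1 + ν) / 2)) (by simp; omega) (by simp)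
    (by simpa using hx) (by
      intro β hβ
      have hlen : ([-ν / 2] ++ List.replicate (r₁ + r₂) (ν / 2)
          ++ List.replicate r₂ ((1 + ν) / 2)).length = d + 1 := by
        simp; omega
      rw [List.append_assoc _ (List.replicate r₂ (ν / 2)), ← hlen, List.take_left] at hβ
      simp only [List.mem_append, List.mem_singleton, List.mem_replicate] at hβ
      rcases hβ with (rfl | ⟨_, rfl⟩) | ⟨_, rfl⟩ <;> simp <;> linarith)
    (by simp; linarith)
  rw [neg_add_cancel, zero_sub, cpow_neg_one, one_div,
    show (1 - 2 * -ν - ν) / 2 = (1 + ν) / 2 by ring,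
    show r₁ + r₂ - 1 = r by omega, ← hcancel]
  simp only [hr, List.replicate_succ' (n := r) (a := (1 + ν) / 2), List.append_assoc]
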